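/- **Proposition 3.2.** Let $r,s$ be integers of the same parity. Let $\mathcal M^!_{r,s}$ be the space of real-analytic $f:\mathfrak H\to\mathbb C$ on the upper half-plane ($z=x+iy$, $q=e^{2\pi i z}$) such that $f(\gamma z)=(cz+d)^r(c\bar z+d)^s f(z)$ for all $\gamma=\left(\begin{smallmatrix}*&*\\c&d\end{smallmatrix}\right)\in\mathrm{SL}_2(\mathbb Z)$, $f(z)=O(e^{Cy})$ as $y\to\infty$ uniformly in $x$ for some $C>0$, and $$f(z)=\sum_{|j|\le M}y^j\sum_{m,n\ge -N}A^{(j)}_{m,n}q^m\bar q^n\qquad (1)$$ for some $M,N\in\mathbb N$, $A_{m,n}^{(j)}\in\mathbb C$, with absolutely convergent inner series. Put $\partial_r=2iy\frac{\partial}{\partial z}+r$, $\bar\partial_s=-2iy\frac{\partial}{\partial\bar z}+s$ and $\Delta_{r,s}=-\bar\partial_{s-1}\partial_r+r(s-1)$. Let $\lambda\in\mathbb R$ and let $f\in\mathcal M^!_{r,s}$ satisfy $\Delta_{r,s}f=\lambda f$. If $f\neq0$, there is $k_0\in\mathbb Z$ with $k_0<1-r-s-k_0$ and $\lambda=k_0(1-r-s-k_0)$.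 For each such $k_0$ (also if $f=0$), there are unique $\alpha,\beta,a_m^{(j)},b_m^{(j)}\in\mathbb C$ such that, for some $N,N'\in\mathbb N$, $$f(z)=\alpha y^{k_0}+\beta y^{1-r-s-k_0}+\sum_{j=k_0}^{-s}y^j\sum_{m\ge -N,\,m\ne0}a_m^{(j)}q^m+\sum_{j=k_0}^{-r}y^j\sum_{m\ge -N',\,m\neq0}b_m^{(j)}\bar q^m,$$ with absolutely convergent inner series (coefficients outside the ranges of summation being $0$). Moreover: 1. For each $j\in\{k_0,\dots,-s\}$ (resp. $j\in\{k_0,\dots,-r\}$) there is $C>0$ such that $a_n^{(j)}=O(e^{C\sqrt n})$ (resp. $b_n^{(j)}=O(e^{C\sqrt n})$) as $n\to\infty$. 2. Let $\Gamma(w,z)=\int_z^\infty e^{-t}t^{w-1}\,dt$ ($z\neq0$) be the incomplete Gamma function, continued to all $w\in\mathbb C$; for $z<0$ logarithms are principal ($\arg z=\pi$) and the path runs through the upper half-plane. With $c_m^{(j)}=a_m^{(j)}+b_m^{(j)}$, both series $$S(w)=\sum_{j\in\mathbb Z}\sum_{m\ne0}\frac{c_m^{(j)}\,\Gamma(w+j,2\pi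 m)}{(2\pi m)^{w+j}}\quad\text{and}\quad S(r+s-w)$$ converge absolutely for every $w\in\mathbb C$. 3. For every expansion (1) of $f$, define $L_f^*(w)=\Lambda(w)+i^{r-s}\Lambda(r+s-w)$, where $$\Lambda(w)=\int_1^\infty\tilde f(it)t^{w-1}dt+\sum_{|j|\le M}\sum_{\substack{m,n\ge -N\\m+n<0}}\frac{A_{m,n}^{(j)}\,\Gamma(j+w,2\pi(m+n))}{(2\pi(m+n))^{j+w}}-\sum_{|j|\le M}\sum_{\substack{m,n\ge -N\\m+n=0}}\frac{A^{(j)}_{m,n}}{w+j}$$ (terms with $A_{m,n}^{(j)}=0$ being omitted) and $\tilde f$ is the sum of the terms of (1) with $m+n>0$. Then for $w\neq -k_0,\,-k_0+1,\,k_0+r+s-1,\,k_0+r+s$, $$L_f^*(w)=S(w)+i^{r-s}S(r+s-w)+\frac{i^{r-s}\alpha}{w-k_0-r-s}+\frac{i^{r-s}\beta}{w+k_0-1}-\frac{\alpha}{w+k_0}-\frac{\beta}{w-k_0-r-s+1}.$$ -/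

import Mathlib

open UpperHalfPlane hiding I
open Complex Filter Asymptotics MeasureTheory
open scoped ComplexConjugate

noncomputable section

namespace RealAnalyticModular

/-! ### Real-analytic modular forms of weights `(r, s)` for `SL(2, ℤ)` -/

/-- The automorphy factor `j(γ, z) = c z + d`, for any complex number `z`. -/
def autFactor (γ : Matrix.SpecialLinearGroup (Fin 2) ℤ) (z : ℂ) : ℂ :=
  ((γ 1 0 : ℤ) : ℂ) * z + ((γ 1 1 : ℤ) : ℂ)

/-- `q = exp(2 π i z)`. -/
def nome (z : ℂ) : ℂ := cexp (2 * Real.pi * I * z)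

/-- The monomial `q ^ m * (conj q) ^ n`. -/
def nomeMonomial (m n : ℤ) (z : ℂ) : ℂ := nome z ^ m * conj (nome z) ^ n

/-- `f(z) = ∑_{|j| ≤ M} y ^ j (∑_{m, n ≥ -N} A j m n * q ^ m * (conj q) ^ n)` on the upper
half-plane, each inner double series being absolutely convergent at every point.
Coefficients outside of the range of summation are zero by convention. -/
structure IsFourierExpansion (f : ℍ → ℂ) (M N : ℕ) (A : ℤ → ℤ → ℤ → ℂ) : Prop where
  support : ∀ j m n : ℤ, ((M : ℤ) < |j| ∨ m < -(N : ℤ) ∨ n < -(N : ℤ)) → A j m n = 0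
  summable : ∀ (j : ℤ) (z : ℍ),
    Summable fun p : ℤ × ℤ => A j p.1 p.2 * nomeMonomial p.1 p.2 (z : ℂ)
  eq : ∀ z : ℍ, f z = ∑ j ∈ Finset.Icc (-(M : ℤ)) (M : ℤ),
    (z.im : ℂ) ^ j * ∑' p : ℤ × ℤ, A j p.1 p.2 * nomeMonomial p.1 p.2 (z : ℂ)

/-- The space of real-analytic modular forms of weights `(r, s)`, with (possibly) exponential
growth at infinity. -/
structure IsModularForm (r s : ℤ) (f : ℍ → ℂ) : Prop where
  analytic : AnalyticOnNhd ℝ (f ∘ ofComplex) {z : ℂ | 0 < z.im}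
  modular : ∀ (γ : Matrix.SpecialLinearGroup (Fin 2) ℤ) (z : ℍ),
    f (γ • z) = autFactor γ (z : ℂ) ^ r * autFactor γ (conj (z : ℂ)) ^ s * f z
  growth : ∃ C : ℝ, 0 < C ∧ f =O[atImInfty] fun z : ℍ => Real.exp (C * z.im)
  expansion : ∃ (M N : ℕ) (A : ℤ → ℤ → ℤ → ℂ), IsFourierExpansion f M N A

/-! ### The Laplacian -/

/-- The Wirtinger derivative `∂f/∂z = (∂f/∂x - i ∂f/∂y) / 2`. -/
def dz (f : ℍ → ℂ) (z : ℍ) : ℂ :=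
  (fderiv ℝ (f ∘ ofComplex) (z : ℂ) 1 - I * fderiv ℝ (f ∘ ofComplex) (z : ℂ) I) / 2

/-- The Wirtinger derivative `∂f/∂(conj z) = (∂f/∂x + i ∂f/∂y) / 2`. -/
def dzbar (f : ℍ → ℂ) (z : ℍ) : ℂ :=
  (fderiv ℝ (f ∘ ofComplex) (z : ℂ) 1 + I * fderiv ℝ (f ∘ ofComplex) (z : ℂ) I) / 2

/-- The operator `2 i y ∂/∂z + r`. -/
def maassRaise (r : ℤ) (f : ℍ → ℂ) (z : ℍ) : ℂ := 2 * I * z.im * dz f z + r * f z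

/-- The operator `- 2 i y ∂/∂(conj z) + s`. -/
def maassLower (s : ℤ) (f : ℍ → ℂ) (z : ℍ) : ℂ := -2 * I * z.im * dzbar f z + s * f z

/-- The Laplacian `Δ_{r, s} = - maassLower (s - 1) ∘ maassRaise r + r (s - 1)`. -/
def laplacian (r s : ℤ) (f : ℍ → ℂ) (z : ℍ) : ℂ :=
  -maassLower (s - 1) (maassRaise r f) z + r * (s - 1) * f z

/-- The forms of weights `(r, s)` in the kernel of `Δ - lam`. -/
structure IsEigenform (r s : ℤ) (lam : ℝ) (f : ℍ → ℂ) : Prop where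
  isModularForm : IsModularForm r s f
  laplacian_eq : ∀ z : ℍ, laplacian r s f z = (lam : ℂ) * f z

/-! ### The Fourier expansion of an eigenform -/

/-- The coefficients `α, β` of the constant term and the coefficients `a j m`, `b j m` of
`y ^ j * q ^ m` and of `y ^ j * (conj q) ^ m`. -/
structure EigenCoeffs where
  α : ℂ
  β : ℂ
  a : ℤ → ℤ → ℂ
  b : ℤ → ℤ → ℂ

/-- The expansion `f(z) = α y ^ k₀ + β y ^ (1 - r - s - k₀)
  + ∑_{j = k₀}^{-s} y ^ j ∑_{m ≥ -N, m ≠ 0} a j m * q ^ m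
  + ∑_{j = k₀}^{-r} y ^ j ∑_{m ≥ -N', m ≠ 0} b j m * (conj q) ^ m` for some `N, N'`.
Coefficients outside of the range of summation are zero by convention. -/
structure IsEigenExpansion (r s k₀ : ℤ) (f : ℍ → ℂ) (E : EigenCoeffs) : Prop where
  support_a : ∃ N : ℕ, ∀ j m : ℤ, (j < k₀ ∨ -s < j ∨ m < -(N : ℤ) ∨ m = 0) → E.a j m = 0
  support_b : ∃ N' : ℕ, ∀ j m : ℤ, (j < k₀ ∨ -r < j ∨ m < -(N' : ℤ) ∨ m = 0) → E.b j m = 0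
  summable_a : ∀ (j : ℤ) (z : ℍ), Summable fun m : ℤ => E.a j m * nome (z : ℂ) ^ m
  summable_b : ∀ (j : ℤ) (z : ℍ), Summable fun m : ℤ => E.b j m * conj (nome (z : ℂ)) ^ m
  eq : ∀ z : ℍ, f z =
    (E.α * (z.im : ℂ) ^ k₀ + E.β * (z.im : ℂ) ^ (1 - r - s - k₀))
    + ∑ j ∈ Finset.Icc k₀ (-s), (z.im : ℂ) ^ j * ∑' m : ℤ, E.a j m * nome (z : ℂ) ^ m
    + ∑ j ∈ Finset.Icc k₀ (-r), (z.im : ℂ) ^ j * ∑' m : ℤ, E.b j m * conj (nome (z : ℂ)) ^ m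

/-! ### The L-function -/

/-- The incomplete Gamma function `Γ(w, z) = ∫_z^∞ e^{-t} t^{w-1} dt` for `z ≠ 0`, with the
principal branch of the logarithm (on the negative axis, `arg z = π`). The path of integration
is the arc of the circle about `0` from `z = |z| e^{i arg z}` to `|z|`, followed by the real
half-line from `|z|` to `∞`; it avoids `0`, so this is an entire function of `w`, and it is the
usual real integral when `z > 0`. -/
def incGamma (w z : ℂ) : ℂ :=
  (∫ t in Set.Ioi ‖z‖, cexp (-(t : ℂ)) * (t : ℂ) ^ (w - 1))
    - I * ∫ θ in (0 : ℝ)..(arg z),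
        cexp (-((‖z‖ : ℂ) * cexp (θ * I))) * ((‖z‖ : ℂ) ^ w * cexp (θ * I * w))

/-- The exponentially decaying part of an expansion: its terms with `m + n > 0`. -/
def decayingPart (M : ℕ) (A : ℤ → ℤ → ℤ → ℂ) (z : ℂ) : ℂ :=
  ∑ j ∈ Finset.Icc (-(M : ℤ)) (M : ℤ), (z.im : ℂ) ^ j *
    ∑' p : ℤ × ℤ, if 0 < p.1 + p.2 then A j p.1 p.2 * nomeMonomial p.1 p.2 z else 0

/-- The Mellin transform `∫_1^∞` of the decaying part at `i t`, plus the regularized one of the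
exponentially growing part (the finitely many terms with `m + n < 0`), minus the contribution
of the constant term (the finitely many terms with `m + n = 0`). -/
def halfL (M N : ℕ) (A : ℤ → ℤ → ℤ → ℂ) (w : ℂ) : ℂ :=
  (∫ t in Set.Ioi (1 : ℝ), decayingPart M A (I * t) * (t : ℂ) ^ (w - 1))
  + (∑ j ∈ Finset.Icc (-(M : ℤ)) (M : ℤ),
      ∑ m ∈ Finset.Icc (-(N : ℤ)) (N : ℤ), ∑ n ∈ Finset.Icc (-(N : ℤ)) (N : ℤ),
        if m + n < 0 then
          A j m n / (2 * Real.pi * ((m : ℂ) + n)) ^ ((j : ℂ) + w)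
            * incGamma ((j : ℂ) + w) (2 * Real.pi * ((m : ℂ) + n))
        else 0)
  - ∑ j ∈ Finset.Icc (-(M : ℤ)) (M : ℤ),
      ∑ m ∈ Finset.Icc (-(N : ℤ)) (N : ℤ), ∑ n ∈ Finset.Icc (-(N : ℤ)) (N : ℤ),
        if m + n = 0 then A j m n / (w + j) else 0

/-- The completed L-function `L*(w)` of a form of weights `(r, s)` with Fourier expansion given
by `M`, `N`, `A` (the coefficients `A` are determined by the form). -/
def completedL (r s : ℤ) (M N : ℕ) (A : ℤ → ℤ → ℤ → ℂ) (w : ℂ) : ℂ :=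
  halfL M N A w + I ^ (r - s) * halfL M N A ((r : ℂ) + s - w)

/-- The term `c_m^{(j)} Γ(w + j, 2 π m) / (2 π m) ^ (w + j)`, where
`c_m^{(j)} = a_m^{(j)} + b_m^{(j)}` and `m ≠ 0`, of the series expression; `p = (j, m)`. -/
def seriesTerm (E : EigenCoeffs) (w : ℂ) (p : ℤ × ℤ) : ℂ :=
  if p.2 = 0 then 0 else
    (E.a p.1 p.2 + E.b p.1 p.2) * incGamma (w + p.1) (2 * Real.pi * (p.2 : ℂ))
      / (2 * Real.pi * (p.2 : ℂ)) ^ (w + p.1)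

/-- The rational function `P(w)` coming from the constant term `α y ^ k₀ + β y ^ (1-r-s-k₀)`. -/
def polarPart (r s k₀ : ℤ) (E : EigenCoeffs) (w : ℂ) : ℂ :=
  I ^ (r - s) * E.α / (w - k₀ - r - s) + I ^ (r - s) * E.β / (w + k₀ - 1)
    - E.α / (w + k₀) - E.β / (w - k₀ - r - s + 1)

end RealAnalyticModular

end

namespace RealAnalyticModular

noncomputable section

/-! ### Double series in `q` and `conj q` -/

/-! Differentiating (1) termwise turns `Δ f = lam f` into a three-term recursion in `j`, separately
for each pair `(m, n)` (`laplacian_sub`, `isEigenRecursion`). This requires Fourier expansions to be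
unique (`IsFourierExpansion.unique`). Integration over `x` isolates the terms with fixed `m - n`;
among them the one with smallest `m + n` dominates as `y → ∞`, so a Laurent polynomial in `y` would
have to decay exponentially, hence vanishes.

For fixed `(m, n)` only finitely many `A j m n` are nonzero, and the ends of this range decide
everything. At the lowest `j` the recursion is the indicial equation `lam = j (1 - r - s - j)`; its
roots are integers with sum `1 - r - s`, which is odd by the parity assumption, so they are distinct
and `k₀` is the smaller one. Two steps above the highest `j` it says `m * n = 0`; one step above,
for `n = 0 ≠ m` (resp. `m = 0 ≠ n`), it says that the highest `j` is `-s` (resp. `-r`). For `m = n =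
0` it is diagonal, so only the two roots survive. This is the stated expansion (`isEigenExpansion`).

For the growth of the coefficients, moving `z` to the fundamental domain gives `f z = O(exp (C /
y))` for `y ≤ 1` (`growth_zero`). For large `n` a single pair of exponents contributes to the `n`-th
Fourier coefficient in `x`, so a Laurent polynomial in `y` with coefficients `a j n` is bounded by
`exp (C / y + 2 π n y)`. Evaluating at boundedly many heights of order `1 / √n` and interpolating
bounds each coefficient (`isBigO_exp_sqrt_of_laurent`).

For the L-function, `Γ(w, x) / x ^ w = ∫_1^∞ exp (-x t) t ^ (w - 1) dt` for `x > 0`, and the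
decaying part is integrated termwise; convergence of the expansion at `i / 2` already dominates the
result for every `w`. The terms with `m < 0` are finitely many and agree on both sides, and the
constant term gives the rational function (`halfL_eq`). -/

lemma nomeMonomial_eq_exp (m n : ℤ) (z : ℂ) :
    nomeMonomial m n z = cexp (2 * Real.pi * I * (m * z - n * conj z)) := by
  rw [nomeMonomial, nome, ← Complex.exp_conj, ← Complex.exp_int_mul, ← Complex.exp_int_mul,
    ← Complex.exp_add]
  congr 1
  simp only [map_mul, conj_ofReal, conj_I, map_ofNat]
  ring

lemma norm_nomeMonomial (m n : ℤ) (z : ℂ) :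
    ‖nomeMonomial m n z‖ = Real.exp (-(2 * Real.pi * (m + n) * z.im)) := by
  rw [nomeMonomial_eq_exp, Complex.norm_exp]
  congr 1
  simp
  ring

/-- The sum of the double series `∑ a (m, n) * q ^ m * (conj q) ^ n`. -/
def doubleSeries (a : ℤ × ℤ → ℂ) (z : ℂ) : ℂ := ∑' p : ℤ × ℤ, a p * nomeMonomial p.1 p.2 z

/-- The coefficients of a double series with finite principal part which is absolutely convergent
on the upper half-plane. -/
structure IsConvergent (N : ℕ) (a : ℤ × ℤ → ℂ) : Prop where
  support : ∀ p : ℤ × ℤ, (p.1 < -(N : ℤ) ∨ p.2 < -(N : ℤ)) → a p = 0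
  summable : ∀ z : ℍ, Summable fun p : ℤ × ℤ => a p * nomeMonomial p.1 p.2 (z : ℂ)

lemma IsConvergent.summable_exp {N : ℕ} {a : ℤ × ℤ → ℂ} (h : IsConvergent N a) {y : ℝ}
    (hy : 0 < y) :
    Summable fun p : ℤ × ℤ => ‖a p‖ * Real.exp (-(2 * Real.pi * (p.1 + p.2) * y)) := by
  have := (h.summable ⟨⟨0, y⟩, hy⟩).norm
  simpa [norm_nomeMonomial] using this

/-- A linear weight costs half of the height: it is absorbed by an exponential, and the series still
converges at `y / 2`. This makes the differentiated series converge. -/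
lemma IsConvergent.summable_weight {N : ℕ} {a : ℤ × ℤ → ℂ} (h : IsConvergent N a) {y : ℝ}
    (hy : 0 < y) :
    Summable fun p : ℤ × ℤ => (|(p.1 : ℝ)| + |(p.2 : ℝ)|) *
      (‖a p‖ * Real.exp (-(2 * Real.pi * (p.1 + p.2) * y))) := by
  have hs := (h.summable_exp (half_pos hy)).mul_left
    (Real.exp (4 * Real.pi * N * y) / (Real.pi * y))
  refine hs.of_nonneg_of_le (fun p => by positivity) fun p => ?_
  by_cases hp : p.1 < -(N : ℤ) ∨ p.2 < -(N : ℤ)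
  · simp [h.support p hp]
  push Not at hp
  have h1 : (-(N : ℝ)) ≤ p.1 := by exact_mod_cast hp.1
  have h2 : (-(N : ℝ)) ≤ p.2 := by exact_mod_cast hp.2
  have hpy : 0 < Real.pi * y := by positivity
  -- Since `p.1, p.2 ≥ -N`, each absolute value is at most the number itself plus `2 * N`.
  set t : ℝ := p.1 + p.2 + 4 * N with ht
  have hm : |(p.1 : ℝ)| + |(p.2 : ℝ)| ≤ t := by
    have e1 : |(p.1 : ℝ)| ≤ p.1 + 2 * N := abs_le.2 ⟨by linarith, by linarith [N.cast_nonneg (α := ℝ)]⟩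
    have e2 : |(p.2 : ℝ)| ≤ p.2 + 2 * N := abs_le.2 ⟨by linarith, by linarith [N.cast_nonneg (α := ℝ)]⟩
    linarith
  have key : t ≤ Real.exp (Real.pi * y * t) / (Real.pi * y) := by
    rw [le_div_iff₀ hpy]
    linarith [Real.add_one_le_exp (Real.pi * y * t)]
  calc (|(p.1 : ℝ)| + |(p.2 : ℝ)|) * (‖a p‖ * Real.exp (-(2 * Real.pi * (p.1 + p.2) * y)))
      ≤ Real.exp (Real.pi * y * t) / (Real.pi * y) *
        (‖a p‖ * Real.exp (-(2 * Real.pi * (p.1 + p.2) * y))) := by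
        gcongr
        exact hm.trans key
    _ = Real.exp (4 * Real.pi * N * y) / (Real.pi * y) *
        (‖a p‖ * Real.exp (-(2 * Real.pi * (p.1 + p.2) * (y / 2)))) := by
        have : Real.exp (Real.pi * y * t) * Real.exp (-(2 * Real.pi * (p.1 + p.2) * y)) =
            Real.exp (4 * Real.pi * N * y) * Real.exp (-(2 * Real.pi * (p.1 + p.2) * (y / 2))) := by
          rw [← Real.exp_add, ← Real.exp_add]
          congr 1
          rw [ht]
          ring
        calc _ = ‖a p‖ / (Real.pi * y) * (Real.exp (Real.pi * y * t) *
              Real.exp (-(2 * Real.pi * (p.1 + p.2) * y))) := by ring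
          _ = _ := by rw [this]; ring

lemma IsConvergent.of_norm_le {N : ℕ} {a b : ℤ × ℤ → ℂ} (h : IsConvergent N a)
    (hb : ∀ p : ℤ × ℤ, ‖b p‖ ≤ (|(p.1 : ℝ)| + |(p.2 : ℝ)|) * ‖a p‖) : IsConvergent N b where
  support p hp := by
    have := hb p
    rw [h.support p hp] at this
    simpa using this
  summable z := by
    refine Summable.of_norm_bounded (h.summable_weight z.im_pos) fun p => ?_
    rw [norm_mul, norm_nomeMonomial, ← mul_assoc]
    exact mul_le_mul_of_nonneg_right (hb p) (Real.exp_pos _).le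

lemma IsConvergent.fst_mul {N : ℕ} {a : ℤ × ℤ → ℂ} (h : IsConvergent N a) :
    IsConvergent N fun p => (p.1 : ℂ) * a p := by
  refine h.of_norm_le fun p => ?_
  rw [norm_mul, Complex.norm_intCast]
  gcongr
  simp

lemma IsConvergent.snd_mul {N : ℕ} {a : ℤ × ℤ → ℂ} (h : IsConvergent N a) :
    IsConvergent N fun p => (p.2 : ℂ) * a p := by
  refine h.of_norm_le fun p => ?_
  rw [norm_mul, Complex.norm_intCast]
  gcongr
  simp

lemma IsConvergent.const_mul {N : ℕ} {a : ℤ × ℤ → ℂ} (h : IsConvergent N a) (c : ℂ) :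
    IsConvergent N fun p => c * a p where
  support p hp := by simp [h.support p hp]
  summable z := by simpa only [mul_assoc] using (h.summable z).mul_left c

lemma IsConvergent.add {N : ℕ} {a b : ℤ × ℤ → ℂ} (h : IsConvergent N a) (h' : IsConvergent N b) :
    IsConvergent N fun p => a p + b p where
  support p hp := by simp [h.support p hp, h'.support p hp]
  summable z := by simpa only [add_mul] using (h.summable z).add (h'.summable z)

lemma doubleSeries_const_mul (a : ℤ × ℤ → ℂ) (c z : ℂ) :
    doubleSeries (fun p => c * a p) z = c * doubleSeries a z := by
  simp only [doubleSeries, mul_assoc, tsum_mul_left]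

lemma IsConvergent.doubleSeries_add {N : ℕ} {a b : ℤ × ℤ → ℂ} (h : IsConvergent N a)
    (h' : IsConvergent N b) (z : ℍ) :
    doubleSeries (fun p => a p + b p) z = doubleSeries a z + doubleSeries b z := by
  simp only [doubleSeries, add_mul]
  exact (h.summable z).tsum_add (h'.summable z)

/-- The real derivative of `q ^ m * (conj q) ^ n`. -/
def monomialDeriv (m n : ℤ) (z : ℂ) : ℂ →L[ℝ] ℂ :=
  (nomeMonomial m n z * (2 * Real.pi * I)) •
    ((m : ℂ) • ContinuousLinearMap.id ℝ ℂ - (n : ℂ) • (conjCLE : ℂ →L[ℝ] ℂ))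

lemma hasFDerivAt_nomeMonomial (m n : ℤ) (z : ℂ) :
    HasFDerivAt (𝕜 := ℝ) (nomeMonomial m n) (monomialDeriv m n z) z := by
  have h1 : HasFDerivAt (𝕜 := ℝ) (fun z : ℂ => 2 * Real.pi * I * (m * z - n * conj z))
      ((2 * Real.pi * I : ℂ) •
        ((m : ℂ) • ContinuousLinearMap.id ℝ ℂ - (n : ℂ) • (conjCLE : ℂ →L[ℝ] ℂ))) z := by
    have hc : HasFDerivAt (𝕜 := ℝ) (fun z : ℂ => conj z) (conjCLE : ℂ →L[ℝ] ℂ) z :=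
      conjCLE.hasFDerivAt
    exact ((((hasFDerivAt_id z).const_mul (m : ℂ)).sub (hc.const_mul (n : ℂ)))).const_mul _
  have h2 := h1.cexp
  rw [← nomeMonomial_eq_exp, smul_smul] at h2
  refine h2.congr_of_eventuallyEq (Eventually.of_forall fun w => ?_)
  exact nomeMonomial_eq_exp m n w

lemma norm_monomialDeriv_le (m n : ℤ) (z : ℂ) :
    ‖monomialDeriv m n z‖ ≤ 2 * Real.pi * ((|(m : ℝ)| + |(n : ℝ)|) *
      Real.exp (-(2 * Real.pi * (m + n) * z.im))) := by
  have h0 : ‖(2 * Real.pi * I : ℂ)‖ = 2 * Real.pi := by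
    simp [abs_of_pos Real.pi_pos]
  rw [monomialDeriv, norm_smul, norm_mul, norm_nomeMonomial, h0]
  have : ‖(m : ℂ) • ContinuousLinearMap.id ℝ ℂ - (n : ℂ) • (conjCLE : ℂ →L[ℝ] ℂ)‖ ≤
      |(m : ℝ)| + |(n : ℝ)| := by
    refine (norm_sub_le _ _).trans ?_
    rw [norm_smul, norm_smul, Complex.norm_intCast, Complex.norm_intCast]
    have := conjCLE_norm
    simp [this]
  calc _ ≤ Real.exp (-(2 * Real.pi * (m + n) * z.im)) * (2 * Real.pi) *
        (|(m : ℝ)| + |(n : ℝ)|) := by gcongr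
    _ = _ := by ring

lemma monomialDeriv_one (m n : ℤ) (z : ℂ) :
    monomialDeriv m n z 1 = nomeMonomial m n z * (2 * Real.pi * I) * (m - n) := by
  simp [monomialDeriv]

lemma monomialDeriv_I (m n : ℤ) (z : ℂ) :
    monomialDeriv m n z I = nomeMonomial m n z * (2 * Real.pi * I) * ((m + n) * I) := by
  simp only [monomialDeriv, smul_apply, sub_apply,
    ContinuousLinearMap.id_apply, ContinuousLinearEquiv.coe_coe, conjCLE_apply, conj_I, smul_eq_mul]
  ring

/-- Termwise differentiation, with the derivatives dominated uniformly on the strip `y / 2 < Im < 2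
y`. As `p.1 + p.2` may have either sign, the majorant adds the values at both edges of the strip. -/
lemma IsConvergent.hasFDerivAt {N : ℕ} {a : ℤ × ℤ → ℂ} (h : IsConvergent N a) {z : ℂ}
    (hz : 0 < z.im) :
    Summable (fun p : ℤ × ℤ => a p • monomialDeriv p.1 p.2 z) ∧
      HasFDerivAt (𝕜 := ℝ) (doubleSeries a) (∑' p : ℤ × ℤ, a p • monomialDeriv p.1 p.2 z) z := by
  obtain ⟨y, hy⟩ : ∃ y, y = z.im := ⟨_, rfl⟩
  have hy0 : 0 < y := hy ▸ hz
  let u : ℤ × ℤ → ℝ := fun p => 2 * Real.pi * ((|(p.1 : ℝ)| + |(p.2 : ℝ)|) *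
      (‖a p‖ * Real.exp (-(2 * Real.pi * (p.1 + p.2) * (y / 2)))) +
      (|(p.1 : ℝ)| + |(p.2 : ℝ)|) *
      (‖a p‖ * Real.exp (-(2 * Real.pi * (p.1 + p.2) * (2 * y)))))
  have hus : Summable u :=
    ((h.summable_weight (half_pos hy0)).add (h.summable_weight (by positivity))).mul_left _
  let S : Set ℂ := Complex.im ⁻¹' Set.Ioo (y / 2) (2 * y)
  have hSo : IsOpen S := isOpen_Ioo.preimage Complex.continuous_im
  have hSc : IsPreconnected S :=
    ((convex_Ioo (y / 2) (2 * y)).is_linear_preimage Complex.imLm.isLinear).isPreconnected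
  have hzS : z ∈ S := Set.mem_preimage.2 ⟨by linarith, by linarith⟩
  have hbound : ∀ (p : ℤ × ℤ) (w : ℂ), w ∈ S → ‖a p • monomialDeriv p.1 p.2 w‖ ≤ u p := by
    intro p w hw
    have hw1 : y / 2 < w.im := hw.1
    have hw2 : w.im < 2 * y := hw.2
    rw [norm_smul]
    have hexp : Real.exp (-(2 * Real.pi * (p.1 + p.2) * w.im)) ≤
        Real.exp (-(2 * Real.pi * (p.1 + p.2) * (y / 2))) +
        Real.exp (-(2 * Real.pi * (p.1 + p.2) * (2 * y))) := by
      rcases le_total 0 ((p.1 : ℝ) + p.2) with hp | hp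
      · have : Real.exp (-(2 * Real.pi * (p.1 + p.2) * w.im)) ≤
            Real.exp (-(2 * Real.pi * (p.1 + p.2) * (y / 2))) := by
          gcongr
        linarith [Real.exp_pos (-(2 * Real.pi * (p.1 + p.2) * (2 * y)))]
      · have : Real.exp (-(2 * Real.pi * (p.1 + p.2) * w.im)) ≤
            Real.exp (-(2 * Real.pi * (p.1 + p.2) * (2 * y))) := by
          rw [Real.exp_le_exp]
          nlinarith [mul_nonneg (mul_nonneg Real.pi_pos.le (neg_nonneg.2 hp))
            (sub_nonneg.2 hw2.le)]
        linarith [Real.exp_pos (-(2 * Real.pi * (p.1 + p.2) * (y / 2)))]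
    calc _ ≤ ‖a p‖ * (2 * Real.pi * ((|(p.1 : ℝ)| + |(p.2 : ℝ)|) *
          (Real.exp (-(2 * Real.pi * (p.1 + p.2) * (y / 2))) +
          Real.exp (-(2 * Real.pi * (p.1 + p.2) * (2 * y)))))) := by
          refine mul_le_mul_of_nonneg_left ?_ (norm_nonneg _)
          refine (norm_monomialDeriv_le _ _ _).trans ?_
          gcongr
      _ = u p := by simp only [u]; ring
  have hsumL : Summable fun p : ℤ × ℤ => a p • monomialDeriv p.1 p.2 z :=
    Summable.of_norm_bounded hus fun p => hbound p z hzS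
  have hderiv : ∀ (p : ℤ × ℤ) (w : ℂ), w ∈ S → HasFDerivAt (𝕜 := ℝ)
      (fun w => a p * nomeMonomial p.1 p.2 w) (a p • monomialDeriv p.1 p.2 w) w :=
    fun p w _ => (hasFDerivAt_nomeMonomial p.1 p.2 w).const_mul (a p)
  exact ⟨hsumL, hasFDerivAt_tsum_of_isPreconnected hus hSo hSc hderiv hbound hzS
      (h.summable ⟨z, hz⟩) hzS⟩

lemma hasSum_monomialDeriv_apply {a : ℤ × ℤ → ℂ} {z : ℂ}
    (hs : Summable (fun p : ℤ × ℤ => a p • monomialDeriv p.1 p.2 z)) (v : ℂ) :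
    HasSum (fun p : ℤ × ℤ => a p * monomialDeriv p.1 p.2 z v)
      ((∑' p : ℤ × ℤ, a p • monomialDeriv p.1 p.2 z) v) :=
  hs.hasSum.mapL (ContinuousLinearMap.apply ℝ ℂ v)

lemma tsum_monomialDeriv_dz {a : ℤ × ℤ → ℂ} {z : ℂ} {L : ℂ →L[ℝ] ℂ}
    (hL : ∀ v : ℂ, HasSum (fun p : ℤ × ℤ => a p * monomialDeriv p.1 p.2 z v) (L v)) :
    (L 1 - I * L I) / 2 = 2 * Real.pi * I * doubleSeries (fun p => p.1 * a p) z := by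
  have h1 := (((hL 1).sub ((hL I).mul_left I)).div_const 2).tsum_eq
  rw [← h1, ← doubleSeries_const_mul, doubleSeries]
  refine tsum_congr fun p => ?_
  rw [monomialDeriv_one, monomialDeriv_I]
  linear_combination (-(2 * Real.pi * I) * a p * nomeMonomial p.1 p.2 z * (p.1 + p.2) / 2) * I_sq

lemma tsum_monomialDeriv_dzbar {a : ℤ × ℤ → ℂ} {z : ℂ} {L : ℂ →L[ℝ] ℂ}
    (hL : ∀ v : ℂ, HasSum (fun p : ℤ × ℤ => a p * monomialDeriv p.1 p.2 z v) (L v)) :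
    (L 1 + I * L I) / 2 = -(2 * Real.pi * I) * doubleSeries (fun p => p.2 * a p) z := by
  have h1 := (((hL 1).add ((hL I).mul_left I)).div_const 2).tsum_eq
  rw [← h1, ← doubleSeries_const_mul, doubleSeries]
  refine tsum_congr fun p => ?_
  rw [monomialDeriv_one, monomialDeriv_I]
  linear_combination ((2 * Real.pi * I) * a p * nomeMonomial p.1 p.2 z * (p.1 + p.2) / 2) * I_sq

lemma IsConvergent.exists_hasFDerivAt {N : ℕ} {a : ℤ × ℤ → ℂ} (h : IsConvergent N a) {z : ℂ}
    (hz : 0 < z.im) :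
    ∃ L : ℂ →L[ℝ] ℂ, HasFDerivAt (doubleSeries a) L z ∧
      (L 1 - I * L I) / 2 = 2 * Real.pi * I * doubleSeries (fun p => p.1 * a p) z ∧
      (L 1 + I * L I) / 2 = -(2 * Real.pi * I) * doubleSeries (fun p => p.2 * a p) z := by
  obtain ⟨hs, hd⟩ := h.hasFDerivAt hz
  exact ⟨_, hd, tsum_monomialDeriv_dz (hasSum_monomialDeriv_apply hs),
    tsum_monomialDeriv_dzbar (hasSum_monomialDeriv_apply hs)⟩

/-! ### The action of the Maass operators on Fourier expansions -/

namespace IsFourierExpansion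

variable {f g : ℍ → ℂ} {M N : ℕ} {A B : ℤ → ℤ → ℤ → ℂ}

lemma isConvergent (h : IsFourierExpansion f M N A) (j : ℤ) :
    IsConvergent N fun p => A j p.1 p.2 where
  support p hp := h.support j p.1 p.2 (Or.inr hp)
  summable := h.summable j

lemma coeff_eq_zero (h : IsFourierExpansion f M N A) {j : ℤ}
    (hj : j ∉ Finset.Icc (-(M : ℤ)) (M : ℤ)) (m n : ℤ) : A j m n = 0 := by
  refine h.support j m n (Or.inl ?_)
  rw [Finset.mem_Icc, ← abs_le] at hj
  exact not_le.1 hj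

/-- Summing over all `j : ℤ` frees the expansion from `M`, so that enlarging the bounds, adding and
shifting `j` become formal. -/
lemma hasSum (h : IsFourierExpansion f M N A) (z : ℍ) :
    HasSum (fun j : ℤ => (z.im : ℂ) ^ j * doubleSeries (fun p => A j p.1 p.2) z) (f z) := by
  rw [h.eq z]
  refine hasSum_sum_of_ne_finset_zero fun j hj => ?_
  simp [doubleSeries, h.coeff_eq_zero hj]

lemma of_hasSum
    (support : ∀ j m n : ℤ, ((M : ℤ) < |j| ∨ m < -(N : ℤ) ∨ n < -(N : ℤ)) → A j m n = 0)
    (conv : ∀ j : ℤ, IsConvergent N fun p => A j p.1 p.2)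
    (hsum : ∀ z : ℍ, HasSum
      (fun j : ℤ => (z.im : ℂ) ^ j * doubleSeries (fun p => A j p.1 p.2) z) (f z)) :
    IsFourierExpansion f M N A where
  support := support
  summable j := (conv j).summable
  eq z := by
    refine (hsum z).unique (hasSum_sum_of_ne_finset_zero fun j hj => ?_)
    rw [Finset.mem_Icc, ← abs_le] at hj
    have : ∀ m n, A j m n = 0 := fun m n => support j m n (Or.inl (not_le.1 hj))
    simp [doubleSeries, this]

lemma mono (h : IsFourierExpansion f M N A) {M' N' : ℕ} (hM : M ≤ M') (hN : N ≤ N') :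
    IsFourierExpansion f M' N' A := by
  have hs : ∀ j m n : ℤ, ((M' : ℤ) < |j| ∨ m < -(N' : ℤ) ∨ n < -(N' : ℤ)) → A j m n = 0 := by
    intro j m n hjmn
    exact h.support j m n (by omega)
  exact of_hasSum hs (fun j => ⟨fun p hp => hs j p.1 p.2 (Or.inr hp), h.summable j⟩) h.hasSum

lemma const_mul (h : IsFourierExpansion f M N A) (c : ℂ) :
    IsFourierExpansion (fun z => c * f z) M N fun j m n => c * A j m n := by
  refine of_hasSum (fun j m n hjmn => by simp [h.support j m n hjmn])
    (fun j => (h.isConvergent j).const_mul c) fun z => ?_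
  refine ((h.hasSum z).mul_left c).congr_fun fun j => ?_
  rw [doubleSeries_const_mul]
  ring

lemma add (h : IsFourierExpansion f M N A) (h' : IsFourierExpansion g M N B) :
    IsFourierExpansion (fun z => f z + g z) M N fun j m n => A j m n + B j m n := by
  refine of_hasSum (fun j m n hjmn => by simp [h.support j m n hjmn, h'.support j m n hjmn])
    (fun j => (h.isConvergent j).add (h'.isConvergent j)) fun z => ?_
  refine ((h.hasSum z).add (h'.hasSum z)).congr_fun fun j => ?_
  rw [(h.isConvergent j).doubleSeries_add (h'.isConvergent j)]
  ring

lemma hasFDerivAt_zpow_im (j : ℤ) {z : ℂ} (hz : 0 < z.im) :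
    HasFDerivAt (𝕜 := ℝ) (fun w : ℂ => (w.im : ℂ) ^ j)
      ((j * (z.im : ℂ) ^ (j - 1)) • (ofRealCLM.comp imCLM)) z := by
  have h1 : HasFDerivAt (𝕜 := ℝ) (fun w : ℂ => (w.im : ℂ)) (ofRealCLM.comp imCLM) z :=
    (ofRealCLM.comp imCLM).hasFDerivAt
  have h2 : HasDerivAt (fun w : ℂ => w ^ j) (j * (z.im : ℂ) ^ (j - 1)) (z.im : ℂ) :=
    hasDerivAt_zpow j _ (Or.inl (by exact_mod_cast hz.ne'))
  exact h2.comp_hasFDerivAt z h1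

/-- The real derivative of a function with a Fourier expansion, through the derivatives of its
partial double series. -/
lemma exists_hasFDerivAt (h : IsFourierExpansion f M N A) (z : ℍ) :
    ∃ L : ℂ →L[ℝ] ℂ, HasFDerivAt (𝕜 := ℝ) (f ∘ ofComplex) L z ∧
      (L 1 - I * L I) / 2 = ∑ j ∈ Finset.Icc (-(M : ℤ)) (M : ℤ), ((z.im : ℂ) ^ j *
        (2 * Real.pi * I * doubleSeries (fun p => p.1 * A j p.1 p.2) z) +
        doubleSeries (fun p => A j p.1 p.2) z * (j * (z.im : ℂ) ^ (j - 1) * (-I / 2))) ∧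
      (L 1 + I * L I) / 2 = ∑ j ∈ Finset.Icc (-(M : ℤ)) (M : ℤ), ((z.im : ℂ) ^ j *
        (-(2 * Real.pi * I) * doubleSeries (fun p => p.2 * A j p.1 p.2) z) +
        doubleSeries (fun p => A j p.1 p.2) z * (j * (z.im : ℂ) ^ (j - 1) * (I / 2))) := by
  choose L hL hL1 hL2 using fun j => (h.isConvergent j).exists_hasFDerivAt (z := z) z.im_pos
  have hd : HasFDerivAt (𝕜 := ℝ)
      (fun w : ℂ => ∑ j ∈ Finset.Icc (-(M : ℤ)) (M : ℤ),
        (w.im : ℂ) ^ j * doubleSeries (fun p => A j p.1 p.2) w)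
      (∑ j ∈ Finset.Icc (-(M : ℤ)) (M : ℤ), (((z : ℂ).im : ℂ) ^ j • L j +
        doubleSeries (fun p => A j p.1 p.2) z •
          ((j * ((z : ℂ).im : ℂ) ^ (j - 1)) • (ofRealCLM.comp imCLM)))) (z : ℂ) :=
    HasFDerivAt.fun_sum fun j _ => (hasFDerivAt_zpow_im j z.im_pos).mul (hL j)
  have heq : (f ∘ ofComplex) =ᶠ[nhds (z : ℂ)] fun w : ℂ => ∑ j ∈ Finset.Icc (-(M : ℤ)) (M : ℤ),
        (w.im : ℂ) ^ j * doubleSeries (fun p => A j p.1 p.2) w := by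
    filter_upwards [isOpen_upperHalfPlaneSet.mem_nhds z.im_pos] with w hw
    rw [Function.comp_apply, ofComplex_apply_of_im_pos hw, h.eq]
    rfl
  refine ⟨_, hd.congr_of_eventuallyEq heq, ?_, ?_⟩
  · simp only [sum_apply, Finset.mul_sum, ← Finset.sum_sub_distrib,
      Finset.sum_div]
    refine Finset.sum_congr rfl fun j _ => ?_
    rw [← hL1 j]
    simp
    ring
  · simp only [sum_apply, Finset.mul_sum, ← Finset.sum_add_distrib,
      Finset.sum_div]
    refine Finset.sum_congr rfl fun j _ => ?_
    rw [← hL2 j]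
    simp
    ring

/-- The common shape of both Maass operators: differentiating `y ^ j` and multiplying by `y`
preserves the exponent, while differentiating the series and multiplying by `y` raises it by one. -/
lemma of_shift {A₁ : ℤ → ℤ → ℤ → ℂ} (hA : ∀ j m n : ℤ,
      ((M : ℤ) < |j| ∨ m < -(N : ℤ) ∨ n < -(N : ℤ)) → A j m n = 0 ∧ A₁ j m n = 0)
    (h0 : ∀ j, IsConvergent N fun p => A j p.1 p.2)
    (h1 : ∀ j, IsConvergent N fun p => A₁ j p.1 p.2)
    (hg : ∀ z : ℍ, g z = ∑ j ∈ Finset.Icc (-(M : ℤ)) (M : ℤ),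
      ((z.im : ℂ) ^ j * doubleSeries (fun p => A j p.1 p.2) z +
        (z.im : ℂ) ^ (j + 1) * doubleSeries (fun p => A₁ j p.1 p.2) z)) :
    IsFourierExpansion g (M + 1) N fun j m n => A j m n + A₁ (j - 1) m n := by
  have hz : ∀ j ∉ Finset.Icc (-(M : ℤ)) (M : ℤ), ∀ m n, A j m n = 0 ∧ A₁ j m n = 0 := by
    intro j hj m n
    rw [Finset.mem_Icc, ← abs_le] at hj
    exact hA j m n (Or.inl (not_le.1 hj))
  refine of_hasSum ?_ (fun j => (h0 j).add (h1 (j - 1))) fun z => ?_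
  · intro j m n hjmn
    have e : (M : ℤ) < |j - 1| ∨ m < -(N : ℤ) ∨ n < -(N : ℤ) := by
      refine hjmn.imp_left fun hj => ?_
      push_cast at hj
      have := abs_sub_abs_le_abs_sub j 1
      rw [abs_one] at this
      omega
    have e' : (M : ℤ) < |j| ∨ m < -(N : ℤ) ∨ n < -(N : ℤ) := by
      refine hjmn.imp_left fun hj => ?_
      push_cast at hj
      omega
    rw [(hA j m n e').1, (hA (j - 1) m n e).2, add_zero]
  · have s0 : HasSum (fun j : ℤ => (z.im : ℂ) ^ j * doubleSeries (fun p => A j p.1 p.2) z)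
        (∑ j ∈ Finset.Icc (-(M : ℤ)) (M : ℤ),
          (z.im : ℂ) ^ j * doubleSeries (fun p => A j p.1 p.2) z) :=
      hasSum_sum_of_ne_finset_zero fun j hj => by simp [doubleSeries, hz j hj]
    have s1 : HasSum (fun j : ℤ => (z.im : ℂ) ^ (j + 1) * doubleSeries (fun p => A₁ j p.1 p.2) z)
        (∑ j ∈ Finset.Icc (-(M : ℤ)) (M : ℤ),
          (z.im : ℂ) ^ (j + 1) * doubleSeries (fun p => A₁ j p.1 p.2) z) :=
      hasSum_sum_of_ne_finset_zero fun j hj => by simp [doubleSeries, hz j hj]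
    have s1' := (Equiv.subRight (1 : ℤ)).hasSum_iff.2 s1
    rw [hg z, Finset.sum_add_distrib]
    refine (s0.add s1').congr_fun fun j => ?_
    rw [(h0 j).doubleSeries_add (h1 (j - 1))]
    simp
    ring

theorem maassRaise (h : IsFourierExpansion f M N A) (r : ℤ) :
    IsFourierExpansion (maassRaise r f) (M + 1) N fun j m n =>
      ((j : ℂ) + r) * A j m n + -(4 * Real.pi) * (m * A (j - 1) m n) := by
  refine of_shift (M := M) (A := fun j m n => ((j : ℂ) + r) * A j m n)
    (A₁ := fun j m n => -(4 * Real.pi) * (m * A j m n))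
    (fun j m n hjmn => by simp [h.support j m n hjmn])
    (fun j => (h.isConvergent j).const_mul _)
    (fun j => (h.isConvergent j).fst_mul.const_mul _) fun z => ?_
  obtain ⟨L, hL, h1, -⟩ := h.exists_hasFDerivAt z
  have hy : (z.im : ℂ) ≠ 0 := by exact_mod_cast z.im_pos.ne'
  rw [RealAnalyticModular.maassRaise, dz, hL.fderiv, h1, h.eq z, Finset.mul_sum, Finset.mul_sum,
    ← Finset.sum_add_distrib]
  refine Finset.sum_congr rfl fun j _ => ?_
  rw [doubleSeries_const_mul, doubleSeries_const_mul, zpow_sub_one₀ hy, zpow_add_one₀ hy]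
  change _ + r * (_ * doubleSeries (fun p => A j p.1 p.2) z) = _
  field_simp
  linear_combination (4 * Real.pi * z.im *
    doubleSeries (fun p => p.1 * A j p.1 p.2) z
    - j * doubleSeries (fun p => A j p.1 p.2) z) * I_sq

theorem maassLower (h : IsFourierExpansion f M N A) (s : ℤ) :
    IsFourierExpansion (maassLower s f) (M + 1) N fun j m n =>
      ((j : ℂ) + s) * A j m n + -(4 * Real.pi) * (n * A (j - 1) m n) := by
  refine of_shift (M := M) (A := fun j m n => ((j : ℂ) + s) * A j m n)
    (A₁ := fun j m n => -(4 * Real.pi) * (n * A j m n))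
    (fun j m n hjmn => by simp [h.support j m n hjmn])
    (fun j => (h.isConvergent j).const_mul _)
    (fun j => (h.isConvergent j).snd_mul.const_mul _) fun z => ?_
  obtain ⟨L, hL, -, h1⟩ := h.exists_hasFDerivAt z
  have hy : (z.im : ℂ) ≠ 0 := by exact_mod_cast z.im_pos.ne'
  rw [RealAnalyticModular.maassLower, dzbar, hL.fderiv, h1, h.eq z, Finset.mul_sum, Finset.mul_sum,
    ← Finset.sum_add_distrib]
  refine Finset.sum_congr rfl fun j _ => ?_
  rw [doubleSeries_const_mul, doubleSeries_const_mul, zpow_sub_one₀ hy, zpow_add_one₀ hy]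
  change _ + s * (_ * doubleSeries (fun p => A j p.1 p.2) z) = _
  field_simp
  linear_combination (4 * Real.pi * z.im *
    doubleSeries (fun p => p.2 * A j p.1 p.2) z
    - j * doubleSeries (fun p => A j p.1 p.2) z) * I_sq

/-- The Fourier expansion of `(Δ - lam) f`. -/
theorem laplacian_sub (h : IsFourierExpansion f M N A) (r s : ℤ) (lam : ℂ) :
    IsFourierExpansion (fun z => laplacian r s f z - lam * f z) (M + 2) N fun j m n =>
      (-(j * (j + r + s - 1)) - lam) * A j m n
        + 4 * Real.pi * (n * (j - 1 + r) + m * (j - 1 + s)) * A (j - 1) m n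
        - 16 * Real.pi ^ 2 * m * n * A (j - 2) m n := by
  have h2 := ((h.maassRaise r).maassLower (s - 1)).const_mul (-1)
  have h3 := h2.add ((h.const_mul ((r : ℂ) * (s - 1) - lam)).mono (by omega) le_rfl)
  convert h3 using 1
  · funext z
    rw [laplacian]
    ring
  · funext j m n
    push_cast
    rw [show j - 1 - 1 = j - 2 by ring]
    ring

end IsFourierExpansion

/-! ### Fourier coefficients and uniqueness of Fourier expansions -/

/-- The point `x + i y`. -/
def planePoint (x y : ℝ) : ℂ := x + y * I

@[simp] lemma planePoint_im (x y : ℝ) : (planePoint x y).im = y := by simp [planePoint]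

lemma integral_exp_int (k : ℤ) :
    ∫ x in (0 : ℝ)..1, cexp (2 * Real.pi * I * k * x) = if k = 0 then 1 else 0 := by
  split_ifs with hk
  · simp [hk]
  · have hc : (2 * Real.pi * I * k : ℂ) ≠ 0 :=
      mul_ne_zero two_pi_I_ne_zero (Int.cast_ne_zero.2 hk)
    rw [integral_exp_mul_complex hc]
    have : cexp (2 * Real.pi * I * k) = 1 := by
      rw [mul_comm]
      exact Complex.exp_int_mul_two_pi_mul_I k
    simp [this]

/-- The frequencies `k p` may repeat: in the application `k p = p.1 - p.2`, and each frequency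
collects a whole diagonal of coefficients. -/
lemma hasSum_fourierCoeff {ι : Type*} [Countable ι] (B : ι → ℂ) (k : ι → ℤ)
    (hB : Summable fun p => ‖B p‖) (l : ℤ) :
    HasSum (fun p => if k p = l then B p else 0)
      (∫ x in (0 : ℝ)..1, (∑' p, B p * cexp (2 * Real.pi * I * k p * x)) *
        cexp (-(2 * Real.pi * I * l * x))) := by
  have hnorm : ∀ (m : ℤ) (x : ℝ), ‖cexp (2 * Real.pi * I * m * x)‖ = 1 := by
    intro m x
    rw [Complex.norm_exp]
    simp
  have hnorm' : ∀ (m : ℤ) (x : ℝ), ‖cexp (-(2 * Real.pi * I * m * x))‖ = 1 := by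
    intro m x
    rw [Complex.norm_exp]
    simp
  have hs : ∀ x : ℝ, Summable fun p => B p * cexp (2 * Real.pi * I * k p * x) := fun x =>
    Summable.of_norm (by simpa [norm_mul, hnorm] using hB)
  have h := intervalIntegral.hasSum_integral_of_dominated_convergence (a := 0) (b := 1)
    (μ := volume)
    (F := fun p (x : ℝ) => B p * cexp (2 * Real.pi * I * k p * x) *
      cexp (-(2 * Real.pi * I * l * x)))
    (f := fun x : ℝ => (∑' p, B p * cexp (2 * Real.pi * I * k p * x)) *
        cexp (-(2 * Real.pi * I * l * x)))
    (fun p _ => ‖B p‖)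
    (fun p => (by fun_prop : Continuous fun x : ℝ => B p * cexp (2 * Real.pi * I * k p * x) *
      cexp (-(2 * Real.pi * I * l * x))).aestronglyMeasurable)
    (fun p => Eventually.of_forall fun x _ => by
      rw [norm_mul, norm_mul, hnorm, hnorm', mul_one, mul_one])
    (Eventually.of_forall fun x _ => hB)
    intervalIntegrable_const
    (Eventually.of_forall fun x _ => (hs x).hasSum.mul_right _)
  refine h.congr_fun fun p => ?_
  have : ∀ x : ℝ, B p * cexp (2 * Real.pi * I * k p * x) * cexp (-(2 * Real.pi * I * l * x)) =
      B p * cexp (2 * Real.pi * I * ((k p - l : ℤ) : ℂ) * x) := by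
    intro x
    rw [mul_assoc, ← Complex.exp_add]
    congr 2
    push_cast
    ring
  simp only [this, intervalIntegral.integral_const_mul, integral_exp_int, sub_eq_zero]
  split_ifs <;> simp

lemma nomeMonomial_planePoint (m n : ℤ) (x y : ℝ) :
    nomeMonomial m n (planePoint x y) =
      cexp (-(2 * Real.pi * (m + n) * y)) * cexp (2 * Real.pi * I * ((m - n : ℤ) : ℂ) * x) := by
  rw [nomeMonomial_eq_exp, ← Complex.exp_add]
  congr 1
  simp only [planePoint, map_add, map_mul, conj_ofReal, conj_I]
  push_cast
  linear_combination (2 * Real.pi * (m + n) * y) * I_sq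

/-- The coefficient of `e ^ (2 π i (m - n) x)` in a Fourier expansion. -/
def rowCoeff (M : ℕ) (A : ℤ → ℤ → ℤ → ℂ) (y : ℝ) (p : ℤ × ℤ) : ℂ :=
  ∑ j ∈ Finset.Icc (-(M : ℤ)) (M : ℤ),
    (y : ℂ) ^ j * (A j p.1 p.2 * cexp (-(2 * Real.pi * (p.1 + p.2) * y)))

namespace IsFourierExpansion

variable {f : ℍ → ℂ} {M N : ℕ} {A : ℤ → ℤ → ℤ → ℂ}

lemma norm_cexp_row (p : ℤ × ℤ) (y : ℝ) : ‖cexp (-(2 * Real.pi * (p.1 + p.2) * y))‖ =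
    Real.exp (-(2 * Real.pi * (p.1 + p.2) * y)) := by
  rw [Complex.norm_exp]
  congr 1
  have : (-(2 * Real.pi * (p.1 + p.2) * y) : ℂ) =
      ((-(2 * Real.pi * (p.1 + p.2) * y) : ℝ) : ℂ) := by push_cast; ring
  rw [this, Complex.ofReal_re]

lemma summable_norm_rowCoeff (h : IsFourierExpansion f M N A) {y : ℝ} (hy : 0 < y) :
    Summable fun p => ‖rowCoeff M A y p‖ := by
  have hs : Summable fun p : ℤ × ℤ => ∑ j ∈ Finset.Icc (-(M : ℤ)) (M : ℤ),
      y ^ j * (‖A j p.1 p.2‖ * Real.exp (-(2 * Real.pi * (p.1 + p.2) * y))) :=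
    summable_sum fun j _ => ((h.isConvergent j).summable_exp hy).mul_left (y ^ j)
  refine hs.of_nonneg_of_le (fun p => norm_nonneg _) fun p => ?_
  refine (norm_sum_le _ _).trans (Finset.sum_le_sum fun j _ => ?_)
  rw [norm_mul, norm_mul, norm_cexp_row, norm_zpow, Complex.norm_real, Real.norm_of_nonneg hy.le]

lemma eq_tsum_rowCoeff (h : IsFourierExpansion f M N A) (x : ℝ) {y : ℝ} (hy : 0 < y) :
    f (ofComplex (planePoint x y)) =
      ∑' p : ℤ × ℤ, rowCoeff M A y p * cexp (2 * Real.pi * I * ((p.1 - p.2 : ℤ) : ℂ) * x) := by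
  have hz : 0 < (planePoint x y).im := by simpa using hy
  rw [ofComplex_apply_of_im_pos hz, h.eq]
  have hs : ∀ j ∈ Finset.Icc (-(M : ℤ)) (M : ℤ), Summable fun p : ℤ × ℤ =>
      (y : ℂ) ^ j * (A j p.1 p.2 * nomeMonomial p.1 p.2 (planePoint x y)) := fun j _ =>
    (h.summable j ⟨_, hz⟩).mul_left _
  have : (⟨planePoint x y, hz⟩ : ℍ).im = y := planePoint_im x y
  simp only [this]
  rw [Finset.sum_congr rfl fun j _ => (tsum_mul_left
    (f := fun p : ℤ × ℤ => A j p.1 p.2 * nomeMonomial p.1 p.2 (planePoint x y))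
    (a := (y : ℂ) ^ j)).symm, ← Summable.tsum_finsetSum hs]
  refine tsum_congr fun p => ?_
  rw [rowCoeff, Finset.sum_mul]
  refine Finset.sum_congr rfl fun j _ => ?_
  rw [nomeMonomial_planePoint]
  ring

lemma hasSum_rowCoeff (h : IsFourierExpansion f M N A) {y : ℝ} (hy : 0 < y) (l : ℤ) :
    HasSum (fun p : ℤ × ℤ => if p.1 - p.2 = l then rowCoeff M A y p else 0)
      (∫ x in (0 : ℝ)..1, f (ofComplex (planePoint x y)) * cexp (-(2 * Real.pi * I * l * x))) := by
  have := hasSum_fourierCoeff _ (fun p : ℤ × ℤ => p.1 - p.2) (h.summable_norm_rowCoeff hy) l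
  simpa only [← h.eq_tsum_rowCoeff _ hy] using this

end IsFourierExpansion

/-- The polynomial `∑ c j * X ^ (j + M)`. -/
def laurentPoly (M : ℕ) (c : ℤ → ℂ) : Polynomial ℂ :=
  ∑ i ∈ Finset.range (2 * M + 1), Polynomial.monomial i (c (i - M))

lemma laurentPoly_coeff {M : ℕ} (c : ℤ → ℂ) {j : ℤ} (hj : j ∈ Finset.Icc (-(M : ℤ)) (M : ℤ)) :
    (laurentPoly M c).coeff (j + M).toNat = c j := by
  rw [Finset.mem_Icc] at hj
  have hi : (j + M).toNat < 2 * M + 1 := by omega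
  have he : (((j + M).toNat : ℕ) : ℤ) - M = j := by omega
  simp only [laurentPoly, Polynomial.finsetSum_coeff, Polynomial.coeff_monomial,
    Finset.sum_ite_eq', Finset.mem_range, hi, if_true, he]

lemma laurentPoly_degree_lt (M : ℕ) (c : ℤ → ℂ) :
    (laurentPoly M c).degree < ((2 * M + 1 : ℕ) : WithBot ℕ) := by
  rw [← Polynomial.mem_degreeLT]
  refine Submodule.sum_mem _ fun i hi => ?_
  rw [Polynomial.mem_degreeLT]
  exact (Polynomial.degree_monomial_le i _).trans_lt
    (by exact_mod_cast Finset.mem_range.1 hi)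

lemma laurentPoly_eval (M : ℕ) (c : ℤ → ℂ) {y : ℝ} (hy : 0 < y) :
    (laurentPoly M c).eval (y : ℂ) =
      (y : ℂ) ^ M * ∑ j ∈ Finset.Icc (-(M : ℤ)) (M : ℤ), (y : ℂ) ^ j * c j := by
  have hy' : (y : ℂ) ≠ 0 := by exact_mod_cast hy.ne'
  simp only [laurentPoly, Polynomial.eval_finsetSum, Polynomial.eval_monomial, Finset.mul_sum]
  refine Finset.sum_nbij' (fun i => (i : ℤ) - M) (fun j => (j + M).toNat) ?_ ?_ ?_ ?_ ?_
  · intro i hi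
    simp at hi ⊢
    omega
  · intro j hj
    simp at hj ⊢
    omega
  · intro i hi
    simp
  · intro j hj
    simp at hj ⊢
    omega
  · intro i hi
    rw [zpow_sub₀ hy', zpow_natCast, zpow_natCast]
    field_simp

/-- A Laurent polynomial which decays exponentially at infinity vanishes. -/
lemma laurent_eq_zero_of_isBigO {M : ℕ} {c : ℤ → ℂ} {K : ℝ} {D : ℝ} (hD : 0 < D)
    (h : ∀ y : ℝ, 1 ≤ y → ‖∑ j ∈ Finset.Icc (-(M : ℤ)) (M : ℤ), (y : ℂ) ^ j * c j‖ ≤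
      K * y ^ M * Real.exp (-(D * y))) :
    ∀ j ∈ Finset.Icc (-(M : ℤ)) (M : ℤ), c j = 0 := by
  set P : Polynomial ℂ := laurentPoly M c with hPdef
  have hlim : Tendsto (fun y : ℝ => ‖P.eval (y : ℂ)‖) atTop (nhds 0) := by
    have h1 : Tendsto (fun y : ℝ => K * (y ^ (2 * M) * Real.exp (-(D * y)))) atTop (nhds 0) := by
      have h2 : Tendsto (fun y : ℝ => y ^ (2 * M) * Real.exp (-D * y)) atTop (nhds 0) := by
        have := tendsto_rpow_mul_exp_neg_mul_atTop_nhds_zero ((2 * M : ℕ) : ℝ) D hD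
        simpa only [Real.rpow_natCast] using this
      simpa using h2.const_mul K
    refine squeeze_zero' (Eventually.of_forall fun _ => norm_nonneg _) ?_ h1
    filter_upwards [eventually_ge_atTop 1] with y hy
    have hy0 : 0 < y := by linarith
    rw [hPdef, laurentPoly_eval M c hy0, norm_mul, norm_pow, Complex.norm_real, Real.norm_of_nonneg hy0.le]
    calc _ ≤ y ^ M * (K * y ^ M * Real.exp (-(D * y))) := by
          gcongr
          exact h y hy
      _ = _ := by ring
  have hP : P = 0 := by
    by_cases hdeg : 0 < P.degree
    · have hz : Tendsto (fun y : ℝ => ‖(y : ℂ)‖) atTop atTop := by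
        simpa only [Complex.norm_real] using tendsto_norm_atTop_atTop
      exact absurd hlim (not_tendsto_nhds_of_tendsto_atTop (P.tendsto_norm_atTop hdeg hz) 0)
    · have hC := Polynomial.eq_C_of_degree_le_zero (not_lt.1 hdeg)
      rw [hC] at hlim
      simp only [Polynomial.eval_C] at hlim
      have := tendsto_nhds_unique hlim tendsto_const_nhds
      rw [hC, norm_eq_zero.1 this.symm, Polynomial.C_0]
  intro j hj
  rw [← laurentPoly_coeff c hj, ← hPdef, hP, Polynomial.coeff_zero]

namespace IsFourierExpansion

variable {f : ℍ → ℂ} {M N M' N' : ℕ} {A B : ℤ → ℤ → ℤ → ℂ}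

/-- On the diagonal of `(m, n)`, the pairs below it drop out by `hlow` and those above have exponent
sum at least `m + n + 2`. The term at `(m, n)` is minus the sum of the latter, hence smaller than
its own exponential by a factor `exp (-4 π y)`, up to a power of `y`. -/
lemma row_eq_zero (h : IsFourierExpansion (fun _ => 0) M N A) {m n : ℤ}
    (hlow : ∀ j n', n' < n → A j (m - n + n') n' = 0) (j : ℤ) : A j m n = 0 := by
  by_cases hj : j ∈ Finset.Icc (-(M : ℤ)) (M : ℤ)
  swap
  · exact h.coeff_eq_zero hj m n
  -- The convergence at height `1` supplies a summable majorant independent of `y`; only the excess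
  -- `y - 1` is left to produce decay.
  let w : ℤ × ℤ → ℝ := fun p => ∑ j ∈ Finset.Icc (-(M : ℤ)) (M : ℤ),
    ‖A j p.1 p.2‖ * Real.exp (-(2 * Real.pi * (p.1 + p.2) * 1))
  have hw : Summable w := summable_sum fun j _ => (h.isConvergent j).summable_exp one_pos
  have hw0 : ∀ p, 0 ≤ w p := fun p => Finset.sum_nonneg fun j _ => by positivity
  refine laurent_eq_zero_of_isBigO (M := M) (c := fun j => A j m n) (D := 4 * Real.pi)
    (K := Real.exp (2 * Real.pi * (m + n + 2)) * ∑' p, w p) (by positivity) (fun y hy => ?_) j hj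
  have hy0 : 0 < y := by linarith
  have hS := h.hasSum_rowCoeff hy0 (m - n)
  simp only [zero_mul, intervalIntegral.integral_zero] at hS
  have hsplit := hS.summable.tsum_eq_add_tsum_ite (m, n)
  rw [hS.tsum_eq] at hsplit
  simp only [if_true] at hsplit
  have hrow : ‖rowCoeff M A y (m, n)‖ ≤
      Real.exp (-(2 * Real.pi * (m + n + 2) * (y - 1))) * y ^ M * ∑' p, w p := by
    rw [eq_neg_of_add_eq_zero_left hsplit.symm, norm_neg, ← tsum_mul_left]
    refine tsum_of_norm_bounded (hw.mul_left _).hasSum fun p => ?_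
    have hpos : 0 ≤ Real.exp (-(2 * Real.pi * (m + n + 2) * (y - 1))) * y ^ M * w p :=
      mul_nonneg (by positivity) (hw0 p)
    split_ifs with h1 h2
    · simpa using hpos
    · rcases lt_or_ge p.2 n with hp | hp
      · have hz : ∀ j, A j p.1 p.2 = 0 := fun j => by
          have := hlow j p.2 hp
          rwa [← h2, sub_add_cancel] at this
        simpa [rowCoeff, hz] using hpos
      · have hne : p.2 ≠ n := fun h3 => h1 (Prod.ext (by omega) h3)
        have hp2 : m + n + 2 ≤ p.1 + p.2 := by omega
        have hp2' : (m : ℝ) + n + 2 ≤ p.1 + p.2 := by exact_mod_cast hp2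
        refine (norm_sum_le _ _).trans ?_
        rw [Finset.mul_sum]
        refine Finset.sum_le_sum fun j hj => ?_
        rw [norm_mul, norm_mul, norm_cexp_row, norm_zpow, Complex.norm_real,
          Real.norm_of_nonneg hy0.le]
        have e1 : y ^ j ≤ y ^ M := by
          rw [← zpow_natCast]
          exact zpow_le_zpow_right₀ hy (Finset.mem_Icc.1 hj).2
        have e2 : Real.exp (-(2 * Real.pi * (p.1 + p.2) * y)) ≤
            Real.exp (-(2 * Real.pi * (m + n + 2) * (y - 1))) *
              Real.exp (-(2 * Real.pi * (p.1 + p.2) * 1)) := by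
          rw [← Real.exp_add, Real.exp_le_exp]
          nlinarith [mul_nonneg (mul_nonneg Real.pi_pos.le (sub_nonneg.2 hp2'))
            (sub_nonneg.2 hy)]
        calc _ ≤ y ^ M * (‖A j p.1 p.2‖ * (Real.exp (-(2 * Real.pi * (m + n + 2) * (y - 1))) *
              Real.exp (-(2 * Real.pi * (p.1 + p.2) * 1)))) := by gcongr
          _ = _ := by ring
    · simpa using hpos
  have hfac : rowCoeff M A y (m, n) = (∑ j ∈ Finset.Icc (-(M : ℤ)) (M : ℤ),
      (y : ℂ) ^ j * A j m n) * cexp (-(2 * Real.pi * (m + n) * y)) := by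
    rw [rowCoeff, Finset.sum_mul]
    exact Finset.sum_congr rfl fun j _ => by ring
  rw [hfac, norm_mul, norm_cexp_row (m, n), ← le_div_iff₀ (Real.exp_pos _)] at hrow
  refine hrow.trans_eq ?_
  rw [div_eq_mul_inv, ← Real.exp_neg]
  have : Real.exp (-(2 * Real.pi * (m + n + 2) * (y - 1))) *
      Real.exp (- -(2 * Real.pi * (m + n) * y)) =
      Real.exp (2 * Real.pi * (m + n + 2)) * Real.exp (-(4 * Real.pi * y)) := by
    rw [← Real.exp_add, ← Real.exp_add]
    congr 1
    ring
  linear_combination (y ^ M * ∑' p, w p) * this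

theorem eq_zero (h : IsFourierExpansion (fun _ => 0) M N A) (j m n : ℤ) : A j m n = 0 := by
  -- Induction upwards along the diagonal `m - n = l`, starting below the support bound `-N`.
  have key : ∀ (k : ℕ) (l j n : ℤ), n < -(N : ℤ) + k → A j (l + n) n = 0 := by
    intro k
    induction k with
    | zero => exact fun l j n hn => h.support j _ n (Or.inr (Or.inr (by simpa using hn)))
    | succ k ih =>
      intro l j n hn
      refine h.row_eq_zero (fun j' n' hn' => ?_) j
      rw [add_sub_cancel_right]
      exact ih l j' n' (by push_cast at hn; omega)
  have := key (n + N + 1).toNat (m - n) j n (by omega)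
  rwa [sub_add_cancel] at this

theorem unique (h : IsFourierExpansion f M N A) (h' : IsFourierExpansion f M' N' B) : A = B := by
  have h1 := (h.mono (le_max_left M M') (le_max_left N N')).add
    ((h'.mono (le_max_right M M') (le_max_right N N')).const_mul (-1))
  have h2 : IsFourierExpansion (fun _ => 0) (max M M') (max N N')
      fun j m n => A j m n + -1 * B j m n := by
    convert h1 using 1
    funext z
    ring
  funext j m n
  linear_combination h2.eq_zero j m n

end IsFourierExpansion

/-! ### The recursion satisfied by the coefficients of an eigenform -/

/-- The coefficients of the Fourier expansion of a solution of `Δ f = lam f`. -/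
structure IsEigenRecursion (r s : ℤ) (lam : ℂ) (A : ℤ → ℤ → ℤ → ℂ) : Prop where
  bounded : ∃ M : ℤ, ∀ j m n : ℤ, A j m n ≠ 0 → -M ≤ j ∧ j ≤ M
  rec_eq : ∀ j m n : ℤ, (-(j * (j + r + s - 1)) - lam) * A j m n
        + 4 * Real.pi * (n * (j - 1 + r) + m * (j - 1 + s)) * A (j - 1) m n
        - 16 * Real.pi ^ 2 * m * n * A (j - 2) m n = 0

lemma IsFourierExpansion.isEigenRecursion {f : ℍ → ℂ} {M N : ℕ} {A : ℤ → ℤ → ℤ → ℂ} {r s : ℤ}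
    {lam : ℂ} (h : IsFourierExpansion f M N A) (hf : ∀ z, laplacian r s f z = lam * f z) :
    IsEigenRecursion r s lam A where
  bounded := by
    refine ⟨M, fun j m n hA => ?_⟩
    by_contra hj
    exact hA (h.coeff_eq_zero (by rwa [Finset.mem_Icc]) m n)
  rec_eq := by
    have h1 := h.laplacian_sub r s lam
    simp only [hf, sub_self] at h1
    exact h1.eq_zero

namespace IsEigenRecursion

variable {r s : ℤ} {lam : ℂ} {A : ℤ → ℤ → ℤ → ℂ}

lemma exists_lowest (h : IsEigenRecursion r s lam A) {j m n : ℤ} (hA : A j m n ≠ 0) :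
    ∃ i ≤ j, lam = ((i * (1 - r - s - i) : ℤ) : ℂ) := by
  obtain ⟨M, hM⟩ := h.bounded
  obtain ⟨i, hi, hmin⟩ := Int.exists_least_of_bdd (P := fun i => A i m n ≠ 0)
    ⟨-M, fun i hi => (hM i m n hi).1⟩ ⟨j, hA⟩
  have hz : ∀ i' < i, A i' m n = 0 := fun i' hi' => by
    by_contra hne
    exact absurd (hmin i' hne) (not_le.2 hi')
  refine ⟨i, hmin j hA, ?_⟩
  have := h.rec_eq i m n
  rw [hz (i - 1) (by omega), hz (i - 2) (by omega), mul_zero, mul_zero, add_zero, sub_zero] at this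
  have h0 := (mul_eq_zero.1 this).resolve_right hi
  push_cast
  linear_combination -h0

lemma exists_highest (h : IsEigenRecursion r s lam A) {j m n : ℤ} (hA : A j m n ≠ 0) :
    ∃ i, j ≤ i ∧ A i m n ≠ 0 ∧ ∀ i', i < i' → A i' m n = 0 := by
  obtain ⟨M, hM⟩ := h.bounded
  obtain ⟨i, hi, hmax⟩ := Int.exists_greatest_of_bdd (P := fun i => A i m n ≠ 0)
    ⟨M, fun i hi => (hM i m n hi).2⟩ ⟨j, hA⟩
  refine ⟨i, hmax j hA, hi, fun i' hi' => ?_⟩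
  by_contra hne
  exact absurd (hmax i' hne) (not_le.2 hi')

lemma mul_eq_zero_of_ne (h : IsEigenRecursion r s lam A) {j m n : ℤ} (hA : A j m n ≠ 0) :
    m = 0 ∨ n = 0 := by
  obtain ⟨i, -, hi, hz⟩ := h.exists_highest hA
  -- With `i` the highest exponent, only the `A (j - 2)` term of the recursion survives here.
  have := h.rec_eq (i + 2) m n
  rw [hz (i + 2) (by omega), hz (i + 2 - 1) (by omega), add_sub_cancel_right] at this
  have hpi : (Real.pi : ℂ) ≠ 0 := Complex.ofReal_ne_zero.2 Real.pi_ne_zero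
  simpa [hi, hpi] using this

lemma le_neg_right (h : IsEigenRecursion r s lam A) {j m : ℤ} (hm : m ≠ 0) (hA : A j m 0 ≠ 0) :
    j ≤ -s := by
  obtain ⟨i, hji, hi, hz⟩ := h.exists_highest hA
  -- For `n = 0` the `A (j - 2)` term is absent, and what is left is `4 π m (i + s) A i m 0 = 0`.
  have := h.rec_eq (i + 1) m 0
  rw [hz (i + 1) (by omega), add_sub_cancel_right] at this
  have hpi : (Real.pi : ℂ) ≠ 0 := Complex.ofReal_ne_zero.2 Real.pi_ne_zero
  simp only [mul_zero, Int.cast_zero, zero_mul, zero_add, sub_zero, mul_eq_zero, hi, hpi,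
    Int.cast_eq_zero, hm, or_false, OfNat.ofNat_ne_zero, false_or] at this
  have h2 : i + s = 0 := by
    have : ((i + s : ℤ) : ℂ) = 0 := by
      push_cast at this ⊢
      linear_combination this
    exact_mod_cast this
  omega

lemma le_neg_left (h : IsEigenRecursion r s lam A) {j n : ℤ} (hn : n ≠ 0) (hA : A j 0 n ≠ 0) :
    j ≤ -r := by
  obtain ⟨i, hji, hi, hz⟩ := h.exists_highest hA
  have := h.rec_eq (i + 1) 0 n
  rw [hz (i + 1) (by omega), add_sub_cancel_right] at this
  have hpi : (Real.pi : ℂ) ≠ 0 := Complex.ofReal_ne_zero.2 Real.pi_ne_zero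
  simp only [mul_zero, Int.cast_zero, zero_mul, zero_add, add_zero, sub_zero, mul_eq_zero, hi, hpi,
    Int.cast_eq_zero, hn, or_false, OfNat.ofNat_ne_zero, false_or] at this
  have h2 : i + r = 0 := by
    have : ((i + r : ℤ) : ℂ) = 0 := by
      push_cast at this ⊢
      linear_combination this
    exact_mod_cast this
  omega

lemma eq_root (h : IsEigenRecursion r s lam A) {j : ℤ} (hA : A j 0 0 ≠ 0) :
    lam = ((j * (1 - r - s - j) : ℤ) : ℂ) := by
  have := h.rec_eq j 0 0
  simp only [Int.cast_zero, zero_mul, mul_zero, add_zero, sub_zero] at this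
  have h0 := (mul_eq_zero.1 this).resolve_right hA
  push_cast
  linear_combination -h0

end IsEigenRecursion

lemma eq_or_eq_of_indicial {r s k₀ i : ℤ} (h : i * (1 - r - s - i) = k₀ * (1 - r - s - k₀)) :
    i = k₀ ∨ i = 1 - r - s - k₀ := by
  have : (i - k₀) * (i - (1 - r - s - k₀)) = 0 := by linear_combination -h
  rcases mul_eq_zero.1 this with h | h
  · exact Or.inl (by omega)
  · exact Or.inr (by omega)

/-! ### Comparison of the two kinds of expansions -/

namespace EigenCoeffs

/-- The coefficients of `q ^ m * (conj q) ^ n` in the expansion given by `E`. -/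
def doubleCoeff (E : EigenCoeffs) (r s k₀ j m n : ℤ) : ℂ :=
  (if m = 0 ∧ n = 0 then
    (if j = k₀ then E.α else 0) + (if j = 1 - r - s - k₀ then E.β else 0) else 0)
  + (if n = 0 then E.a j m else 0) + (if m = 0 then E.b j n else 0)

variable {r s k₀ : ℤ} {E : EigenCoeffs}

lemma hasSum_doubleCoeff {j : ℤ} {z : ℂ} (ha : Summable fun m : ℤ => E.a j m * nome z ^ m)
    (hb : Summable fun m : ℤ => E.b j m * conj (nome z) ^ m) :
    HasSum (fun p : ℤ × ℤ => E.doubleCoeff r s k₀ j p.1 p.2 * nomeMonomial p.1 p.2 z)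
      ((if j = k₀ then E.α else 0) + (if j = 1 - r - s - k₀ then E.β else 0)
        + ∑' m : ℤ, E.a j m * nome z ^ m + ∑' m : ℤ, E.b j m * conj (nome z) ^ m) := by
  have h0 := hasSum_ite_eq ((0, 0) : ℤ × ℤ)
    ((if j = k₀ then E.α else 0) + (if j = 1 - r - s - k₀ then E.β else 0))
  have h1 : HasSum (fun p : ℤ × ℤ => if p.2 = 0 then E.a j p.1 * nome z ^ p.1 else 0)
      (∑' m : ℤ, E.a j m * nome z ^ m) := by
    have hinj : Function.Injective fun m : ℤ => ((m, 0) : ℤ × ℤ) := fun m n h => by simpa using h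
    refine (hinj.hasSum_iff fun p hp => ?_).1 ?_
    · rw [if_neg]
      exact fun h => hp ⟨p.1, Prod.ext rfl h.symm⟩
    · simpa [Function.comp_def] using ha.hasSum
  have h2 : HasSum (fun p : ℤ × ℤ => if p.1 = 0 then E.b j p.2 * conj (nome z) ^ p.2 else 0)
      (∑' m : ℤ, E.b j m * conj (nome z) ^ m) := by
    have hinj : Function.Injective fun m : ℤ => ((0, m) : ℤ × ℤ) := fun m n h => by simpa using h
    refine (hinj.hasSum_iff fun p hp => ?_).1 ?_
    · rw [if_neg]
      exact fun h => hp ⟨p.2, Prod.ext h.symm rfl⟩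
    · simpa [Function.comp_def] using hb.hasSum
  refine ((h0.add h1).add h2).congr_fun fun p => ?_
  obtain ⟨m, n⟩ := p
  by_cases hm : m = 0 <;> by_cases hn : n = 0 <;>
    simp [doubleCoeff, nomeMonomial, hm, hn]

lemma doubleCoeff_eq_zero {j m n : ℤ} (h : ¬(m = 0 ∧ n = 0 ∧ (j = k₀ ∨ j = 1 - r - s - k₀)))
    (ha : n = 0 → E.a j m = 0) (hb : m = 0 → E.b j n = 0) : E.doubleCoeff r s k₀ j m n = 0 := by
  have e1 : (if n = 0 then E.a j m else 0) = 0 := by split_ifs with hn; exacts [ha hn, rfl]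
  have e2 : (if m = 0 then E.b j n else 0) = 0 := by split_ifs with hn; exacts [hb hn, rfl]
  rw [doubleCoeff, e1, e2]
  split_ifs <;> simp_all

lemma doubleCoeff_left {j m : ℤ} (hm : m ≠ 0) :
    E.doubleCoeff r s k₀ j m 0 = E.a j m := by
  simp [doubleCoeff, hm]

lemma doubleCoeff_right {j n : ℤ} (hn : n ≠ 0) :
    E.doubleCoeff r s k₀ j 0 n = E.b j n := by
  simp [doubleCoeff, hn]

/-- The terms of an expansion, summed over the exponents of `y`. -/
lemma hasSum_doubleSeries (ha0 : ∀ j m : ℤ, (j < k₀ ∨ -s < j) → E.a j m = 0)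
    (hb0 : ∀ j m : ℤ, (j < k₀ ∨ -r < j) → E.b j m = 0) {z : ℍ}
    (ha : ∀ j : ℤ, Summable fun m : ℤ => E.a j m * nome (z : ℂ) ^ m)
    (hb : ∀ j : ℤ, Summable fun m : ℤ => E.b j m * conj (nome (z : ℂ)) ^ m) :
    HasSum (fun j : ℤ => (z.im : ℂ) ^ j *
        doubleSeries (fun p => E.doubleCoeff r s k₀ j p.1 p.2) z)
      ((E.α * (z.im : ℂ) ^ k₀ + E.β * (z.im : ℂ) ^ (1 - r - s - k₀))
      + ∑ j ∈ Finset.Icc k₀ (-s), (z.im : ℂ) ^ j * ∑' m : ℤ, E.a j m * nome (z : ℂ) ^ m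
      + ∑ j ∈ Finset.Icc k₀ (-r), (z.im : ℂ) ^ j *
          ∑' m : ℤ, E.b j m * conj (nome (z : ℂ)) ^ m) := by
  have h1 := hasSum_ite_eq k₀ (E.α * (z.im : ℂ) ^ k₀)
  have h2 := hasSum_ite_eq (1 - r - s - k₀) (E.β * (z.im : ℂ) ^ (1 - r - s - k₀))
  have h3 : HasSum (fun j : ℤ => (z.im : ℂ) ^ j * ∑' m : ℤ, E.a j m * nome (z : ℂ) ^ m)
      (∑ j ∈ Finset.Icc k₀ (-s), (z.im : ℂ) ^ j * ∑' m : ℤ, E.a j m * nome (z : ℂ) ^ m) :=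
    hasSum_sum_of_ne_finset_zero fun j hj => by
      have : ∀ m, E.a j m = 0 := fun m => ha0 j m (by rw [Finset.mem_Icc] at hj; omega)
      simp [this]
  have h4 : HasSum (fun j : ℤ => (z.im : ℂ) ^ j * ∑' m : ℤ, E.b j m * conj (nome (z : ℂ)) ^ m)
      (∑ j ∈ Finset.Icc k₀ (-r), (z.im : ℂ) ^ j *
        ∑' m : ℤ, E.b j m * conj (nome (z : ℂ)) ^ m) :=
    hasSum_sum_of_ne_finset_zero fun j hj => by
      have : ∀ m, E.b j m = 0 := fun m => hb0 j m (by rw [Finset.mem_Icc] at hj; omega)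
      simp [this]
  refine (((h1.add h2).add h3).add h4).congr_fun fun j => ?_
  rw [doubleSeries, (hasSum_doubleCoeff (ha j) (hb j)).tsum_eq]
  have e1 : (if j = k₀ then E.α * (z.im : ℂ) ^ k₀ else 0) =
      (z.im : ℂ) ^ j * (if j = k₀ then E.α else 0) := by
    split_ifs with h
    · rw [h, mul_comm]
    · rw [mul_zero]
  have e2 : (if j = 1 - r - s - k₀ then E.β * (z.im : ℂ) ^ (1 - r - s - k₀) else 0) =
      (z.im : ℂ) ^ j * (if j = 1 - r - s - k₀ then E.β else 0) := by
    split_ifs with h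
    · rw [h, mul_comm]
    · rw [mul_zero]
  rw [e1, e2]
  ring

end EigenCoeffs

namespace IsEigenExpansion

variable {r s k₀ : ℤ} {f : ℍ → ℂ} {E E' : EigenCoeffs}

lemma a_eq_zero (h : IsEigenExpansion r s k₀ f E) {j m : ℤ} (hj : j < k₀ ∨ -s < j ∨ m = 0) :
    E.a j m = 0 := by
  obtain ⟨N, hN⟩ := h.support_a
  exact hN j m (by tauto)

lemma b_eq_zero (h : IsEigenExpansion r s k₀ f E) {j m : ℤ} (hj : j < k₀ ∨ -r < j ∨ m = 0) :
    E.b j m = 0 := by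
  obtain ⟨N, hN⟩ := h.support_b
  exact hN j m (by tauto)

theorem isFourierExpansion (h : IsEigenExpansion r s k₀ f E) :
    ∃ M N : ℕ, IsFourierExpansion f M N (E.doubleCoeff r s k₀) := by
  obtain ⟨N₁, hN₁⟩ := h.support_a
  obtain ⟨N₂, hN₂⟩ := h.support_b
  refine ⟨k₀.natAbs + (1 - r - s - k₀).natAbs + r.natAbs + s.natAbs, N₁ + N₂, ?_⟩
  have hsupp : ∀ j m n : ℤ,
      (((k₀.natAbs + (1 - r - s - k₀).natAbs + r.natAbs + s.natAbs : ℕ) : ℤ) < |j| ∨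
        m < -((N₁ + N₂ : ℕ) : ℤ) ∨ n < -((N₁ + N₂ : ℕ) : ℤ)) →
      E.doubleCoeff r s k₀ j m n = 0 := by
    intro j m n hjmn
    rw [Int.abs_eq_natAbs] at hjmn
    refine EigenCoeffs.doubleCoeff_eq_zero (by omega) (fun hn => hN₁ j m ?_)
      (fun hm => hN₂ j n ?_) <;> omega
  refine IsFourierExpansion.of_hasSum hsupp (fun j => ⟨fun p hp => hsupp j p.1 p.2 (Or.inr hp),
    fun z => (EigenCoeffs.hasSum_doubleCoeff (h.summable_a j z) (h.summable_b j z)).summable⟩)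
    fun z => ?_
  rw [h.eq z]
  exact EigenCoeffs.hasSum_doubleSeries (fun j m hj => h.a_eq_zero (by tauto))
    (fun j m hj => h.b_eq_zero (by tauto)) (fun j => h.summable_a j z) (fun j => h.summable_b j z)

theorem doubleCoeff_eq (h : IsEigenExpansion r s k₀ f E) {M N : ℕ} {A : ℤ → ℤ → ℤ → ℂ}
    (hA : IsFourierExpansion f M N A) : A = E.doubleCoeff r s k₀ := by
  obtain ⟨M', N', h'⟩ := h.isFourierExpansion
  exact hA.unique h'

lemma doubleCoeff_zero (h : IsEigenExpansion r s k₀ f E) (j : ℤ) :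
    E.doubleCoeff r s k₀ j 0 0 =
      (if j = k₀ then E.α else 0) + (if j = 1 - r - s - k₀ then E.β else 0) := by
  simp [EigenCoeffs.doubleCoeff, h.a_eq_zero, h.b_eq_zero]

/-- Reduces to uniqueness of the double expansion. The strict inequality separates the two powers of
`y` in the constant term, so that `α` and `β` can be read off individually. -/
theorem unique (hk : k₀ < 1 - r - s - k₀) (h : IsEigenExpansion r s k₀ f E)
    (h' : IsEigenExpansion r s k₀ f E') : E = E' := by
  obtain ⟨M, N, hA⟩ := h.isFourierExpansion
  have heq := h'.doubleCoeff_eq hA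
  have hα : E.α = E'.α := by
    have := congrFun (congrFun (congrFun heq k₀) 0) 0
    rw [h.doubleCoeff_zero, h'.doubleCoeff_zero] at this
    simpa [hk.ne] using this
  have hβ : E.β = E'.β := by
    have := congrFun (congrFun (congrFun heq (1 - r - s - k₀)) 0) 0
    rw [h.doubleCoeff_zero, h'.doubleCoeff_zero] at this
    simpa [hk.ne'] using this
  have ha : E.a = E'.a := by
    funext j m
    by_cases hm : m = 0
    · rw [h.a_eq_zero (by tauto), h'.a_eq_zero (by tauto)]
    · rw [← EigenCoeffs.doubleCoeff_left hm, heq, EigenCoeffs.doubleCoeff_left hm]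
  have hb : E.b = E'.b := by
    funext j m
    by_cases hm : m = 0
    · rw [h.b_eq_zero (by tauto), h'.b_eq_zero (by tauto)]
    · rw [← EigenCoeffs.doubleCoeff_right hm, heq, EigenCoeffs.doubleCoeff_right hm]
  cases E
  cases E'
  simp_all

end IsEigenExpansion

/-- The coefficients of an eigenform, read off from its Fourier expansion. -/
def EigenCoeffs.ofDouble (r s k₀ : ℤ) (A : ℤ → ℤ → ℤ → ℂ) : EigenCoeffs where
  α := A k₀ 0 0
  β := A (1 - r - s - k₀) 0 0
  a j m := if m = 0 then 0 else A j m 0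
  b j n := if n = 0 then 0 else A j 0 n

theorem IsFourierExpansion.isEigenExpansion {f : ℍ → ℂ} {M N : ℕ} {A : ℤ → ℤ → ℤ → ℂ}
    {r s k₀ : ℤ} (h : IsFourierExpansion f M N A) (hk : k₀ < 1 - r - s - k₀)
    (hrec : IsEigenRecursion r s ((k₀ * (1 - r - s - k₀) : ℤ) : ℂ) A) :
    IsEigenExpansion r s k₀ f (EigenCoeffs.ofDouble r s k₀ A) := by
  -- The lowest exponent is an indicial root, and `k₀` is the smaller of the two.
  have hlow : ∀ {j m n : ℤ}, A j m n ≠ 0 → k₀ ≤ j := fun {j m n} hA => by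
    obtain ⟨i, hij, hi⟩ := hrec.exists_lowest hA
    have := eq_or_eq_of_indicial (r := r) (s := s) (k₀ := k₀) (i := i) (by exact_mod_cast hi.symm)
    omega
  have hA : ∀ j, (fun p : ℤ × ℤ => (EigenCoeffs.ofDouble r s k₀ A).doubleCoeff r s k₀ j p.1 p.2) =
      fun p : ℤ × ℤ => A j p.1 p.2 := by
    intro j
    funext ⟨m, n⟩
    by_cases hm : m = 0 <;> by_cases hn : n = 0
    · subst hm hn
      simp only [EigenCoeffs.doubleCoeff, EigenCoeffs.ofDouble, and_self, if_true, add_zero]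
      by_cases h0 : A j 0 0 = 0
      · by_cases e1 : j = k₀ <;> by_cases e2 : j = 1 - r - s - k₀ <;> simp_all
      · have := eq_or_eq_of_indicial (r := r) (s := s) (k₀ := k₀) (i := j)
          (by exact_mod_cast (hrec.eq_root h0).symm)
        rcases this with e | e
        · simp [e, hk.ne]
        · simp [e, hk.ne']
    · simp [EigenCoeffs.doubleCoeff, EigenCoeffs.ofDouble, hm, hn]
    · simp [EigenCoeffs.doubleCoeff, EigenCoeffs.ofDouble, hm, hn]
    · have : A j m n = 0 := by
        by_contra hne
        have := hrec.mul_eq_zero_of_ne hne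
        tauto
      simp [EigenCoeffs.doubleCoeff, hm, hn, this]
  have hsa : ∀ j m : ℤ, (j < k₀ ∨ -s < j ∨ m < -(N : ℤ) ∨ m = 0) →
      (EigenCoeffs.ofDouble r s k₀ A).a j m = 0 := by
    intro j m hjm
    simp only [EigenCoeffs.ofDouble, ite_eq_left_iff]
    intro hm
    by_contra hne
    have h1 := hlow hne
    have h2 := hrec.le_neg_right hm hne
    have h3 : ¬(m < -(N : ℤ)) := fun h3 => hne (h.support j m 0 (Or.inr (Or.inl h3)))
    omega
  have hsb : ∀ j m : ℤ, (j < k₀ ∨ -r < j ∨ m < -(N : ℤ) ∨ m = 0) →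
      (EigenCoeffs.ofDouble r s k₀ A).b j m = 0 := by
    intro j m hjm
    simp only [EigenCoeffs.ofDouble, ite_eq_left_iff]
    intro hm
    by_contra hne
    have h1 := hlow hne
    have h2 := hrec.le_neg_left hm hne
    have h3 : ¬(m < -(N : ℤ)) := fun h3 => hne (h.support j 0 m (Or.inr (Or.inr h3)))
    omega
  have ha : ∀ (j : ℤ) (z : ℍ),
      Summable fun m : ℤ => (EigenCoeffs.ofDouble r s k₀ A).a j m * nome (z : ℂ) ^ m := by
    intro j z
    have hinj : Function.Injective fun m : ℤ => ((m, 0) : ℤ × ℤ) := fun m n h => by simpa using h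
    refine (((h.summable j z).comp_injective hinj).indicator {0}ᶜ).congr fun m => ?_
    by_cases hm : m = 0 <;> simp [EigenCoeffs.ofDouble, nomeMonomial, hm]
  have hb : ∀ (j : ℤ) (z : ℍ),
      Summable fun m : ℤ => (EigenCoeffs.ofDouble r s k₀ A).b j m * conj (nome (z : ℂ)) ^ m := by
    intro j z
    have hinj : Function.Injective fun m : ℤ => ((0, m) : ℤ × ℤ) := fun m n h => by simpa using h
    refine (((h.summable j z).comp_injective hinj).indicator {0}ᶜ).congr fun m => ?_
    by_cases hm : m = 0 <;> simp [EigenCoeffs.ofDouble, nomeMonomial, hm]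
  refine ⟨⟨N, hsa⟩, ⟨N, hsb⟩, ha, hb, fun z => ?_⟩
  have hsum := EigenCoeffs.hasSum_doubleSeries (r := r) (s := s) (k₀ := k₀)
    (E := EigenCoeffs.ofDouble r s k₀ A)
    (fun j m hj => hsa j m (by tauto)) (fun j m hj => hsb j m (by tauto))
    (fun j => ha j z) (fun j => hb j z)
  simp only [hA] at hsum
  exact (h.hasSum z).unique hsum

/-! ### The eigenvalue, and the expansion of an eigenform -/

theorem IsEigenform.exists_root {r s : ℤ} (hrs : Even (r - s)) {lam : ℝ} {f : ℍ → ℂ}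
    (hf : IsEigenform r s lam f) (h0 : f ≠ 0) :
    ∃ k₀ : ℤ, k₀ < 1 - r - s - k₀ ∧ lam = ((k₀ * (1 - r - s - k₀) : ℤ) : ℝ) := by
  obtain ⟨M, N, A, hA⟩ := hf.isModularForm.expansion
  obtain ⟨j, m, n, hne⟩ : ∃ j m n, A j m n ≠ 0 := by
    by_contra! hall
    refine h0 (funext fun z => ?_)
    rw [hA.eq z]
    simp [hall]
  obtain ⟨i, -, hi⟩ := (hA.isEigenRecursion hf.laplacian_eq).exists_lowest hne
  have hi' : lam = ((i * (1 - r - s - i) : ℤ) : ℝ) := by exact_mod_cast hi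
  obtain ⟨t, ht⟩ := hrs
  rcases lt_or_ge i (1 - r - s - i) with h | h
  · exact ⟨i, h, hi'⟩
  -- The other root. It is strictly below `i` because parity rules out `2 * i = 1 - r - s`.
  · refine ⟨1 - r - s - i, by omega, ?_⟩
    rw [hi']
    push_cast
    ring

theorem IsEigenform.existsUnique_expansion {r s k₀ : ℤ} {lam : ℝ} {f : ℍ → ℂ}
    (hf : IsEigenform r s lam f) (hk : k₀ < 1 - r - s - k₀)
    (hlam : lam = ((k₀ * (1 - r - s - k₀) : ℤ) : ℝ)) :
    ∃! E : EigenCoeffs, IsEigenExpansion r s k₀ f E := by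
  obtain ⟨M, N, A, hA⟩ := hf.isModularForm.expansion
  have hlam' : (lam : ℂ) = ((k₀ * (1 - r - s - k₀) : ℤ) : ℂ) := by
    rw [hlam, Complex.ofReal_intCast]
  have hrec := hA.isEigenRecursion hf.laplacian_eq
  rw [hlam'] at hrec
  exact ⟨_, hA.isEigenExpansion hk hrec, fun E' h' => h'.unique hk (hA.isEigenExpansion hk hrec)⟩

/-! ### Growth of modular forms at the real line and of their Fourier coefficients -/

namespace IsModularForm

variable {r s : ℤ} {f : ℍ → ℂ}

/-- The growth condition controls `f` above some height `Y`; below it the strip is compact. The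
region contains the standard fundamental domain. -/
lemma growth_strip (hf : IsModularForm r s f) : ∃ K C : ℝ, 0 ≤ K ∧ 0 < C ∧
    ∀ w : ℍ, |w.re| ≤ 1 / 2 → 1 / 2 ≤ w.im → ‖f w‖ ≤ K * Real.exp (C * w.im) := by
  obtain ⟨C, hC, hO⟩ := hf.growth
  obtain ⟨K₀, hK₀⟩ := hO.bound
  obtain ⟨Y, hY⟩ := (atImInfty_mem _).1 hK₀
  have hcomp : IsCompact (Set.Icc (-(1 / 2) : ℝ) (1 / 2) ×ℂ Set.Icc (1 / 2 : ℝ) Y) :=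
    isCompact_Icc.reProdIm isCompact_Icc
  have hcont : ContinuousOn (f ∘ ofComplex)
      (Set.Icc (-(1 / 2) : ℝ) (1 / 2) ×ℂ Set.Icc (1 / 2 : ℝ) Y) := by
    refine hf.analytic.continuousOn.mono fun z hz => ?_
    have : (1 / 2 : ℝ) ≤ z.im := hz.2.1
    exact lt_of_lt_of_le (by norm_num) this
  obtain ⟨K₁, hK₁⟩ := hcomp.exists_bound_of_continuousOn hcont
  refine ⟨|K₀| + |K₁|, C, by positivity, hC, fun w hre him => ?_⟩
  have hexp : 1 ≤ Real.exp (C * w.im) := Real.one_le_exp (by positivity)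
  rcases le_total Y w.im with h | h
  · have h1 : ‖f w‖ ≤ K₀ * ‖Real.exp (C * w.im)‖ := hY w h
    rw [Real.norm_of_nonneg (Real.exp_pos _).le] at h1
    refine h1.trans (mul_le_mul_of_nonneg_right ?_ (Real.exp_pos _).le)
    linarith [le_abs_self K₀, abs_nonneg K₁]
  · have h1 := hK₁ (w : ℂ) ⟨abs_le.1 hre, him, h⟩
    rw [Function.comp_apply, ofComplex_apply] at h1
    have h2 : (|K₀| + |K₁|) * 1 ≤ (|K₀| + |K₁|) * Real.exp (C * w.im) := by gcongr
    linarith [le_abs_self K₁, abs_nonneg K₀]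

lemma autFactor_conj (γ : Matrix.SpecialLinearGroup (Fin 2) ℤ) (z : ℂ) :
    autFactor γ (conj z) = conj (autFactor γ z) := by
  simp [autFactor]

lemma im_le_norm_autFactor (γ : Matrix.SpecialLinearGroup (Fin 2) ℤ) {z : ℍ} (hz : z.im ≤ 1) :
    z.im ≤ ‖autFactor γ (z : ℂ)‖ := by
  by_cases hc : γ 1 0 = 0
  · have hd : γ 1 1 ≠ 0 := by
      intro hd
      have := Matrix.det_fin_two γ.1
      rw [γ.2] at this
      simp [hc, hd] at this
    have h1 : (1 : ℝ) ≤ |(γ 1 1 : ℝ)| := by exact_mod_cast Int.one_le_abs hd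
    rw [autFactor, hc, Int.cast_zero, zero_mul, zero_add, Complex.norm_intCast]
    linarith
  · have h1 : (1 : ℝ) ≤ |(γ 1 0 : ℝ)| := by exact_mod_cast Int.one_le_abs hc
    have h2 := Complex.abs_im_le_norm (autFactor γ (z : ℂ))
    have h3 : (autFactor γ (z : ℂ)).im = γ 1 0 * z.im := by simp [autFactor]
    rw [h3, abs_mul, abs_of_pos z.im_pos] at h2
    nlinarith [z.im_pos]

lemma im_smul_eq (γ : Matrix.SpecialLinearGroup (Fin 2) ℤ) (z : ℍ) :
    (γ • z).im = z.im / ‖autFactor γ (z : ℂ)‖ ^ 2 := by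
  rw [ModularGroup.im_smul_eq_div_normSq, ModularGroup.denom_apply, Complex.normSq_eq_norm_sq]
  rfl

/-- A modular form grows at most like `exp (C / y)` as `y → 0`, uniformly in `x`. -/
theorem growth_zero (hf : IsModularForm r s f) : ∃ K C : ℝ, 0 ≤ K ∧ 0 < C ∧
    ∀ z : ℍ, z.im ≤ 1 → ‖f z‖ ≤ K * Real.exp (C / z.im) := by
  obtain ⟨K, C, hK, hC, h⟩ := hf.growth_strip
  -- The extra `2 * |r + s|` pays for the automorphy factor: its absolute value `d` satisfies `y ≤ d
  -- ≤ 2`, so `d ^ (-(r + s))` is at most `(2 / y) ^ |r + s|`.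
  refine ⟨K, C + 2 * (r + s).natAbs, hK, by positivity, fun z hz => ?_⟩
  obtain ⟨γ, hγ⟩ := ModularGroup.exists_smul_mem_fd z
  have hy := z.im_pos
  have him : 1 / 2 ≤ (γ • z).im := by
    nlinarith [ModularGroup.three_le_four_mul_im_sq_of_mem_fd hγ, (γ • z).im_pos]
  have hw := h (γ • z) hγ.2 him
  have hd1 : z.im ≤ ‖autFactor γ (z : ℂ)‖ := im_le_norm_autFactor γ hz
  have hd0 : 0 < ‖autFactor γ (z : ℂ)‖ := hy.trans_le hd1
  have hmod : ‖f (γ • z)‖ = ‖autFactor γ (z : ℂ)‖ ^ (r + s) * ‖f z‖ := by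
    rw [hf.modular, autFactor_conj, norm_mul, norm_mul, norm_zpow, norm_zpow, norm_conj,
      zpow_add₀ hd0.ne']
  rw [im_smul_eq] at him hw
  generalize ‖autFactor γ (z : ℂ)‖ = d at *
  have hd2 : d ≤ 2 := by
    rw [le_div_iff₀ (by positivity)] at him
    nlinarith
  -- From `y ≤ d`: the translate lies no higher than `1 / y`, which turns `exp (C * Im (γ z))` into
  -- `exp (C / y)`.
  have himle : z.im / d ^ 2 ≤ 1 / z.im := by
    rw [div_le_div_iff₀ (by positivity) hy]
    nlinarith
  have hfz : ‖f z‖ = d ^ (-(r + s)) * ‖f (γ • z)‖ := by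
    rw [hmod, ← mul_assoc, ← zpow_add₀ hd0.ne']
    simp
  have h1 : d ≤ 2 / z.im := hd2.trans (by rw [le_div_iff₀ hy]; linarith)
  have h2 : d⁻¹ ≤ 2 / z.im := by
    rw [inv_eq_one_div, div_le_div_iff₀ hd0 hy]
    linarith
  have hpow : d ^ (-(r + s)) ≤ (2 / z.im) ^ (r + s).natAbs := by
    rcases le_total 0 (r + s) with hk | hk
    · rw [zpow_neg, ← inv_zpow]
      conv_lhs => rw [← Int.natAbs_of_nonneg hk, zpow_natCast]
      gcongr
    · have : -(r + s) = ((r + s).natAbs : ℤ) := by omega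
      conv_lhs => rw [this, zpow_natCast]
      gcongr
  have hpow2 : (2 / z.im) ^ (r + s).natAbs ≤ Real.exp (2 * (r + s).natAbs / z.im) := by
    have : 2 / z.im ≤ Real.exp (2 / z.im) := by linarith [Real.add_one_le_exp (2 / z.im)]
    calc _ ≤ Real.exp (2 / z.im) ^ (r + s).natAbs := by gcongr
      _ = _ := by
        rw [← Real.exp_nat_mul]
        congr 1
        ring
  calc ‖f z‖ ≤ Real.exp (2 * (r + s).natAbs / z.im) * (K * Real.exp (C * (1 / z.im))) := by
        rw [hfz]
        gcongr
        · exact hpow.trans hpow2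
        · exact hw.trans (by gcongr)
    _ = K * Real.exp ((C + 2 * (r + s).natAbs) / z.im) := by
        rw [mul_left_comm, ← Real.exp_add]
        congr 2
        ring

end IsModularForm

/-- Lagrange interpolation at fixed nodes, so that the constant depends on `D` alone. The nodes `1,
…, D` avoid `0` because they are later rescaled to heights in the upper half-plane. -/
lemma exists_norm_coeff_le (D : ℕ) : ∃ K : ℝ, 0 ≤ K ∧ ∀ P : Polynomial ℂ, P.degree < (D : WithBot ℕ) →
    ∀ i, i < D → ‖P.coeff i‖ ≤ K * ∑ k ∈ Finset.range D, ‖P.eval ((k : ℂ) + 1)‖ := by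
  let v : ℕ → ℂ := fun k => (k : ℂ) + 1
  have hv : Set.InjOn v (Finset.range D) := fun a _ b _ hab => by simpa [v] using hab
  refine ⟨∑ i ∈ Finset.range D, ∑ k ∈ Finset.range D,
    ‖(Lagrange.basis (Finset.range D) v k).coeff i‖,
    Finset.sum_nonneg fun _ _ => Finset.sum_nonneg fun _ _ => norm_nonneg _, fun P hP i hi => ?_⟩
  conv_lhs => rw [Lagrange.eq_interpolate hv (f := P) (by simpa using hP),
    Lagrange.interpolate_apply, Polynomial.finsetSum_coeff]
  refine (norm_sum_le _ _).trans ?_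
  rw [Finset.mul_sum]
  refine Finset.sum_le_sum fun k hk => ?_
  rw [Polynomial.coeff_C_mul, norm_mul, mul_comm]
  refine mul_le_mul_of_nonneg_right ?_ (norm_nonneg _)
  refine le_trans ?_ (Finset.single_le_sum (f := fun i => ∑ k ∈ Finset.range D,
    ‖(Lagrange.basis (Finset.range D) v k).coeff i‖)
    (fun _ _ => Finset.sum_nonneg fun _ _ => norm_nonneg _) (Finset.mem_range.2 hi))
  exact Finset.single_le_sum (f := fun k => ‖(Lagrange.basis (Finset.range D) v k).coeff i‖)
    (fun _ _ => norm_nonneg _) hk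

/-- If a sequence of Laurent polynomials is at most `K * exp (C / y + 2 π n y)` on `(0, 1]`, then
its coefficients are at most `exp (C' √n)`. -/
lemma isBigO_exp_sqrt_of_laurent {M : ℕ} {c : ℕ → ℤ → ℂ} {K C : ℝ} (hK : 0 ≤ K) (hC : 0 < C)
    (h : ∀ᶠ n : ℕ in atTop, ∀ y : ℝ, 0 < y → y ≤ 1 →
      ‖∑ j ∈ Finset.Icc (-(M : ℤ)) (M : ℤ), (y : ℂ) ^ j * c n j‖ ≤
        K * Real.exp (C / y + 2 * Real.pi * n * y))
    {j : ℤ} (hj : j ∈ Finset.Icc (-(M : ℤ)) (M : ℤ)) :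
    ∃ C' : ℝ, 0 < C' ∧ (fun n : ℕ => c n j) =O[atTop] fun n : ℕ => Real.exp (C' * √(n : ℝ)) := by
  obtain ⟨D, hD⟩ : ∃ D, D = 2 * M + 1 := ⟨_, rfl⟩
  have hDr : (1 : ℝ) ≤ D := by
    rw [hD]
    push_cast
    linarith [M.cast_nonneg (α := ℝ)]
  obtain ⟨K₁, hK₁, hcoeff⟩ := exists_norm_coeff_le D
  -- The sample heights are `y = (k + 1) / (D √n)` with `k < D`, all in `(0, 1]`. There `C / y ≤ C D
  -- √n` and `2 π n y ≤ 2 π √n`; the summand `M * D` comes from undoing the rescaling by `(D √n) ^ j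
  -- ≤ exp (M D √n)`.
  refine ⟨C * D + 2 * Real.pi + M * D, by positivity,
    IsBigO.of_bound (K₁ * ∑ k ∈ Finset.range D, (D : ℝ) ^ M * K) ?_⟩
  filter_upwards [h, eventually_ge_atTop 1] with n hn hn1
  have hsq : (1 : ℝ) ≤ √(n : ℝ) := Real.one_le_sqrt.2 (by exact_mod_cast hn1)
  have hT : (1 : ℝ) ≤ D * √(n : ℝ) := by nlinarith
  have hT0 : (0 : ℝ) < D * √(n : ℝ) := by linarith
  have ht0 : (0 : ℝ) < (D * √(n : ℝ))⁻¹ := inv_pos.2 hT0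
  have hP := hcoeff (laurentPoly M fun j => (((D * √(n : ℝ))⁻¹ : ℝ) : ℂ) ^ j * c n j)
    (hD ▸ laurentPoly_degree_lt M _) (j + M).toNat (by rw [Finset.mem_Icc] at hj; omega)
  rw [laurentPoly_coeff _ hj, norm_mul, norm_zpow, Complex.norm_real,
    Real.norm_of_nonneg ht0.le, inv_zpow] at hP
  have heval : ∀ k ∈ Finset.range D,
      ‖(laurentPoly M fun j => (((D * √(n : ℝ))⁻¹ : ℝ) : ℂ) ^ j * c n j).eval ((k : ℂ) + 1)‖ ≤
      (D : ℝ) ^ M * K * Real.exp ((C * D + 2 * Real.pi) * √(n : ℝ)) := by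
    intro k hk
    have hk1 : (k : ℝ) + 1 ≤ D := by exact_mod_cast Finset.mem_range.1 hk
    have hk0 : (0 : ℝ) < (k : ℝ) + 1 := by positivity
    have e1 : ((k : ℂ) + 1) = (((k : ℝ) + 1 : ℝ) : ℂ) := by push_cast; ring
    rw [e1, laurentPoly_eval M _ hk0, norm_mul, norm_pow, Complex.norm_real,
      Real.norm_of_nonneg hk0.le, mul_assoc]
    have hy1 : ((k : ℝ) + 1) * (D * √(n : ℝ))⁻¹ ≤ 1 := by
      rw [← div_eq_mul_inv, div_le_one hT0]
      nlinarith
    have := hn (((k : ℝ) + 1) * (D * √(n : ℝ))⁻¹) (by positivity) hy1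
    have e2 : ∑ j ∈ Finset.Icc (-(M : ℤ)) (M : ℤ),
        (((k : ℝ) + 1 : ℝ) : ℂ) ^ j * ((((D * √(n : ℝ))⁻¹ : ℝ) : ℂ) ^ j * c n j) =
        ∑ j ∈ Finset.Icc (-(M : ℤ)) (M : ℤ),
        ((((k : ℝ) + 1) * (D * √(n : ℝ))⁻¹ : ℝ) : ℂ) ^ j * c n j := by
      refine Finset.sum_congr rfl fun j _ => ?_
      rw [Complex.ofReal_mul, mul_zpow, mul_assoc]
    rw [e2]
    refine mul_le_mul (by gcongr) (this.trans ?_) (norm_nonneg _) (by positivity)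
    gcongr
    have e3 : C / (((k : ℝ) + 1) * (D * √(n : ℝ))⁻¹) ≤ C * D * √(n : ℝ) := by
      rw [div_le_iff₀ (by positivity)]
      have : C * D * √(n : ℝ) * (((k : ℝ) + 1) * (D * √(n : ℝ))⁻¹) = C * ((k : ℝ) + 1) := by
        field_simp
      rw [this]
      nlinarith [k.cast_nonneg (α := ℝ)]
    have e4 : 2 * Real.pi * n * (((k : ℝ) + 1) * (D * √(n : ℝ))⁻¹) ≤ 2 * Real.pi * √(n : ℝ) := by
      have hnn : (n : ℝ) = √(n : ℝ) * √(n : ℝ) := (Real.mul_self_sqrt n.cast_nonneg).symm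
      have : 2 * Real.pi * n * (((k : ℝ) + 1) * (D * √(n : ℝ))⁻¹) =
          2 * Real.pi * √(n : ℝ) * (((k : ℝ) + 1) / D) := by
        conv_lhs => rw [hnn]
        rw [Real.sqrt_mul_self (Real.sqrt_nonneg _)]
        field_simp
      rw [this]
      refine mul_le_of_le_one_right (by positivity) ?_
      rw [div_le_one (by positivity)]
      exact hk1
    linarith
  rw [Real.norm_of_nonneg (Real.exp_pos _).le]
  have hTj : (D * √(n : ℝ)) ^ j ≤ Real.exp (M * D * √(n : ℝ)) := by
    calc (D * √(n : ℝ)) ^ j ≤ (D * √(n : ℝ)) ^ (M : ℤ) :=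
          zpow_le_zpow_right₀ hT (Finset.mem_Icc.1 hj).2
      _ ≤ Real.exp (D * √(n : ℝ)) ^ M := by
          rw [zpow_natCast]
          gcongr
          linarith [Real.add_one_le_exp (D * √(n : ℝ))]
      _ = _ := by
          rw [← Real.exp_nat_mul]
          congr 1
          ring
  have hTj0 : 0 < (D * √(n : ℝ)) ^ j := zpow_pos hT0 j
  calc ‖c n j‖ = (D * √(n : ℝ)) ^ j * (((D * √(n : ℝ)) ^ j)⁻¹ * ‖c n j‖) := by
        rw [mul_inv_cancel_left₀ hTj0.ne']
    _ ≤ Real.exp (M * D * √(n : ℝ)) * (K₁ * ∑ k ∈ Finset.range D,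
          (D : ℝ) ^ M * K * Real.exp ((C * D + 2 * Real.pi) * √(n : ℝ))) := by
        refine mul_le_mul hTj (hP.trans ?_) (by positivity) (Real.exp_pos _).le
        gcongr with k hk
        exact heval k hk
    _ = _ := by
        rw [← Finset.sum_mul, ← mul_assoc, mul_comm, add_mul (C * D + 2 * Real.pi), Real.exp_add]
        ring

/-- When `(m, n)` is alone on its diagonal, its contribution is a full Fourier coefficient in `x`,
and so is bounded by the supremum of `f` on the horizontal line. -/
lemma IsFourierExpansion.norm_rowCoeff_le {f : ℍ → ℂ} {M N : ℕ} {A : ℤ → ℤ → ℤ → ℂ}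
    (h : IsFourierExpansion f M N A) {m n : ℤ}
    (hA : ∀ m' n', (m', n') ≠ (m, n) → m' - n' = m - n → ∀ j, A j m' n' = 0) {y B : ℝ}
    (hy : 0 < y) (hB : ∀ z : ℍ, z.im = y → ‖f z‖ ≤ B) :
    ‖∑ j ∈ Finset.Icc (-(M : ℤ)) (M : ℤ), (y : ℂ) ^ j * A j m n‖ ≤
      B * Real.exp (2 * Real.pi * (m + n) * y) := by
  have h1 := h.hasSum_rowCoeff hy (m - n)
  have h2 := hasSum_single (f := fun p : ℤ × ℤ =>
    if p.1 - p.2 = m - n then rowCoeff M A y p else 0) (m, n) fun p hp => by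
      split_ifs with hl
      · simp [rowCoeff, hA p.1 p.2 hp hl]
      · rfl
  rw [if_pos rfl] at h2
  have hfac : rowCoeff M A y (m, n) = (∑ j ∈ Finset.Icc (-(M : ℤ)) (M : ℤ),
      (y : ℂ) ^ j * A j m n) * cexp (-(2 * Real.pi * (m + n) * y)) := by
    rw [rowCoeff, Finset.sum_mul]
    exact Finset.sum_congr rfl fun j _ => by ring
  have h3 : ‖rowCoeff M A y (m, n)‖ ≤ B * |(1 : ℝ) - 0| := by
    rw [h2.unique h1]
    refine intervalIntegral.norm_integral_le_of_norm_le_const fun x _ => ?_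
    have hz : 0 < (planePoint x y).im := by simpa using hy
    have he : ‖cexp (-(2 * Real.pi * I * ((m - n : ℤ) : ℂ) * x))‖ = 1 := by
      rw [Complex.norm_exp]
      simp
    rw [norm_mul, he, mul_one, ofComplex_apply_of_im_pos hz]
    exact hB _ (planePoint_im x y)
  rw [hfac, norm_mul, norm_cexp_row (m, n), sub_zero, abs_one, mul_one,
    ← le_div_iff₀ (Real.exp_pos _), div_eq_mul_inv, ← Real.exp_neg, neg_neg] at h3
  exact h3

/-! ### Growth of the coefficients of an eigenform -/

namespace IsEigenExpansion

variable {r s k₀ : ℤ} {f : ℍ → ℂ} {E : EigenCoeffs}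

theorem isBigO_a (h : IsEigenExpansion r s k₀ f E) (hf : IsModularForm r s f) (j : ℤ) :
    ∃ C : ℝ, 0 < C ∧
      (fun n : ℕ => E.a j (n : ℤ)) =O[atTop] fun n : ℕ => Real.exp (C * √(n : ℝ)) := by
  obtain ⟨M, N, hA⟩ := h.isFourierExpansion
  obtain ⟨K, C, hK, hC, hgrowth⟩ := hf.growth_zero
  obtain ⟨N', hN'⟩ := h.support_b
  -- Enlarging `M` puts the given `j` into the range of the Laurent polynomial.
  have hA' := hA.mono (Nat.le_add_right M j.natAbs) (le_refl N)
  refine isBigO_exp_sqrt_of_laurent (M := M + j.natAbs) (c := fun n j => E.a j n) hK hC ?_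
    (by rw [Finset.mem_Icc]; omega)
  -- The diagonal of `(n, 0)` also meets the other axis at `(0, -n)`; past `N'` the coefficient `b j
  -- (-n)` is zero.
  filter_upwards [eventually_gt_atTop N'] with n hn y hy0 hy1
  have := hA'.norm_rowCoeff_le (m := n) (n := 0) (y := y) (B := K * Real.exp (C / y)) ?_ hy0
    fun z hz => hz ▸ hgrowth z (hz ▸ hy1)
  · simp only [EigenCoeffs.doubleCoeff_left (E := E) (r := r) (s := s) (k₀ := k₀)
      (by omega : (n : ℤ) ≠ 0)] at this
    simpa [Real.exp_add, mul_assoc] using this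
  · intro m' n' hne hl j
    have hne' : ¬(m' = n ∧ n' = 0) := by simpa using hne
    exact EigenCoeffs.doubleCoeff_eq_zero (by omega) (by omega) fun _ => hN' _ _ (by omega)

theorem isBigO_b (h : IsEigenExpansion r s k₀ f E) (hf : IsModularForm r s f) (j : ℤ) :
    ∃ C : ℝ, 0 < C ∧
      (fun n : ℕ => E.b j (n : ℤ)) =O[atTop] fun n : ℕ => Real.exp (C * √(n : ℝ)) := by
  obtain ⟨M, N, hA⟩ := h.isFourierExpansion
  obtain ⟨K, C, hK, hC, hgrowth⟩ := hf.growth_zero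
  obtain ⟨N', hN'⟩ := h.support_a
  have hA' := hA.mono (Nat.le_add_right M j.natAbs) (le_refl N)
  refine isBigO_exp_sqrt_of_laurent (M := M + j.natAbs) (c := fun n j => E.b j n) hK hC ?_
    (by rw [Finset.mem_Icc]; omega)
  filter_upwards [eventually_gt_atTop N'] with n hn y hy0 hy1
  have := hA'.norm_rowCoeff_le (m := 0) (n := n) (y := y) (B := K * Real.exp (C / y)) ?_ hy0
    fun z hz => hz ▸ hgrowth z (hz ▸ hy1)
  · simp only [EigenCoeffs.doubleCoeff_right (E := E) (r := r) (s := s) (k₀ := k₀)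
      (by omega : (n : ℤ) ≠ 0)] at this
    simpa [Real.exp_add, mul_assoc] using this
  · intro m' n' hne hl j
    have hne' : ¬(m' = 0 ∧ n' = n) := by simpa using hne
    exact EigenCoeffs.doubleCoeff_eq_zero (by omega) (fun _ => hN' _ _ (by omega)) (by omega)

end IsEigenExpansion

/-! ### The L-function of an eigenform -/

lemma hasSum_of_rows {α : Type*} [AddCommMonoid α] [TopologicalSpace α] [ContinuousAdd α]
    {S : Finset ℤ} {g : ℤ × ℤ → α} {a : ℤ → α} (h0 : ∀ j ∉ S, ∀ m, g (j, m) = 0)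
    (h : ∀ j ∈ S, HasSum (fun m => g (j, m)) (a j)) : HasSum g (∑ j ∈ S, a j) := by
  have h1 : ∀ j ∈ S, HasSum (fun p : ℤ × ℤ => if p.1 = j then g p else 0) (a j) := by
    intro j hj
    have hinj : Function.Injective fun m : ℤ => ((j, m) : ℤ × ℤ) := fun m n h => by simpa using h
    refine (hinj.hasSum_iff fun p hp => ?_).1 ?_
    · rw [if_neg]
      exact fun h => hp ⟨p.2, Prod.ext h.symm rfl⟩
    · simpa [Function.comp_def] using h j hj
  refine (hasSum_sum h1).congr_fun fun p => ?_
  by_cases hp : p.1 ∈ S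
  · simp [hp]
  · simp [h0 p.1 hp p.2]

/-- For positive argument the arc in `incGamma` is trivial, and the substitution `t ↦ x t` moves the
lower limit to `1`. -/
lemma incGamma_div_cpow (w : ℂ) {x : ℝ} (hx : 0 < x) :
    incGamma w x / (x : ℂ) ^ w = ∫ t in Set.Ioi (1 : ℝ), cexp (-(x * t)) * (t : ℂ) ^ (w - 1) := by
  have hx' : (x : ℂ) ≠ 0 := by exact_mod_cast hx.ne'
  rw [incGamma, Complex.arg_ofReal_of_nonneg hx.le, intervalIntegral.integral_same, mul_zero,
    sub_zero, Complex.norm_real, Real.norm_of_nonneg hx.le]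
  have h1 := integral_comp_mul_left_Ioi' (fun t : ℝ => cexp (-(t : ℂ)) * (t : ℂ) ^ (w - 1)) 1 hx
  rw [mul_one] at h1
  have h2 : ∫ t in Set.Ioi (1 : ℝ), cexp (-((x * t : ℝ) : ℂ)) * ((x * t : ℝ) : ℂ) ^ (w - 1) =
      (x : ℂ) ^ (w - 1) * ∫ t in Set.Ioi (1 : ℝ), cexp (-(x * t)) * (t : ℂ) ^ (w - 1) := by
    rw [← integral_const_mul]
    refine setIntegral_congr_fun measurableSet_Ioi fun t ht => ?_
    have ht0 : (0 : ℝ) ≤ t := zero_le_one.trans (le_of_lt ht)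
    simp only [Complex.ofReal_mul]
    rw [Complex.mul_cpow_ofReal_nonneg hx.le ht0]
    ring
  rw [← h1, h2, Complex.real_smul, Complex.cpow_sub _ _ hx', Complex.cpow_one]
  have : (x : ℂ) ^ w ≠ 0 := by simp [Complex.cpow_eq_zero_iff, hx']
  field_simp

lemma integrableOn_rpow_mul_exp {τ : ℝ} (hτ : 0 ≤ τ) :
    IntegrableOn (fun t : ℝ => t ^ τ * Real.exp (-(2 * Real.pi * (t - 1 / 2)))) (Set.Ioi 1) := by
  have h := integrableOn_rpow_mul_exp_neg_mul_rpow (s := τ) (p := 1) (b := 2 * Real.pi)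
    (by linarith) one_pos (by positivity)
  have h1 := (h.mono_set (Set.Ioi_subset_Ioi zero_le_one)).mul_const (Real.exp Real.pi)
  refine h1.congr (Eventually.of_forall fun t => ?_)
  simp only [Real.rpow_one]
  rw [mul_assoc, ← Real.exp_add]
  congr 2
  ring

/-- The terms of the Mellin transform of the decaying part of an eigenform. -/
def mellinTerm (c : ℤ × ℤ → ℂ) (w : ℂ) (p : ℤ × ℤ) (t : ℝ) : ℂ :=
  c p * (cexp (-((2 * Real.pi * p.2 : ℝ) * t)) * (t : ℂ) ^ (w + p.1 - 1))

/-- Splits `t = 1 / 2 + (t - 1 / 2)` in `exp (-2 π m t)`. The first part gives `exp (-π m)`, the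
size of `q ^ m` at `i / 2`, which is summable against the coefficients; the second, with `m`
replaced by `1`, is integrable in `t`. -/
lemma norm_mellinTerm_le {c : ℤ × ℤ → ℂ} (hc : ∀ p : ℤ × ℤ, p.2 ≤ 0 → c p = 0) (w : ℂ)
    (p : ℤ × ℤ) {t : ℝ} (ht : 1 < t) :
    ‖mellinTerm c w p t‖ ≤ ‖c p‖ * Real.exp (-(Real.pi * p.2)) *
      (t ^ |(w + p.1 - 1).re| * Real.exp (-(2 * Real.pi * (t - 1 / 2)))) := by
  rcases le_or_gt p.2 0 with hp | hp
  · simp [mellinTerm, hc p hp]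
  have hm : (1 : ℝ) ≤ p.2 := by exact_mod_cast hp
  have ht0 : 0 < t := by linarith
  have hexp : ‖cexp (-((2 * Real.pi * p.2 : ℝ) * t))‖ = Real.exp (-(2 * Real.pi * p.2 * t)) := by
    rw [← Complex.ofReal_mul, ← Complex.ofReal_neg, Complex.norm_exp, Complex.ofReal_re]
  rw [mellinTerm, norm_mul, norm_mul, Complex.norm_cpow_eq_rpow_re_of_pos ht0, hexp]
  have e1 : Real.exp (-(2 * Real.pi * p.2 * t)) ≤
      Real.exp (-(Real.pi * p.2)) * Real.exp (-(2 * Real.pi * (t - 1 / 2))) := by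
    rw [← Real.exp_add, Real.exp_le_exp]
    nlinarith [mul_nonneg (mul_nonneg Real.pi_pos.le (sub_nonneg.2 hm))
      (by linarith : (0 : ℝ) ≤ t - 1 / 2)]
  have e2 : t ^ (w + p.1 - 1).re ≤ t ^ |(w + p.1 - 1).re| :=
    Real.rpow_le_rpow_of_exponent_le ht.le (le_abs_self _)
  calc _ ≤ ‖c p‖ * (Real.exp (-(Real.pi * p.2)) * Real.exp (-(2 * Real.pi * (t - 1 / 2))) *
        t ^ |(w + p.1 - 1).re|) := by gcongr
    _ = _ := by ring

lemma integrableOn_mellinTerm {c : ℤ × ℤ → ℂ} (hc : ∀ p : ℤ × ℤ, p.2 ≤ 0 → c p = 0) (w : ℂ)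
    (p : ℤ × ℤ) : IntegrableOn (mellinTerm c w p) (Set.Ioi 1) := by
  refine Integrable.mono' ((integrableOn_rpow_mul_exp (abs_nonneg (w + p.1 - 1).re)).const_mul
    (‖c p‖ * Real.exp (-(Real.pi * p.2)))) ?_ ?_
  · refine ContinuousOn.aestronglyMeasurable ?_ measurableSet_Ioi
    intro t ht
    have ht0 : (0 : ℝ) < t := zero_lt_one.trans ht
    have h1 : ContinuousAt (fun t : ℝ => (t : ℂ) ^ (w + p.1 - 1)) t :=
      Complex.continuousAt_ofReal_cpow_const _ _ (Or.inr ht0.ne')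
    have h2 : ContinuousAt (fun t : ℝ => cexp (-((2 * Real.pi * p.2 : ℝ) * t))) t := by fun_prop
    exact (continuousAt_const.mul (h2.mul h1)).continuousWithinAt
  · exact (ae_restrict_iff' measurableSet_Ioi).2
      (Eventually.of_forall fun t ht => norm_mellinTerm_le hc w p (Set.mem_Ioi.1 ht))

lemma summable_integral_norm_mellinTerm {c : ℤ × ℤ → ℂ} (hc : ∀ p : ℤ × ℤ, p.2 ≤ 0 → c p = 0)
    {S : Finset ℤ} (hS : ∀ j ∉ S, ∀ m, c (j, m) = 0)
    (hsum : ∀ j, Summable fun m : ℤ => ‖c (j, m)‖ * Real.exp (-(Real.pi * m))) (w : ℂ) :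
    Summable fun p => ∫ t in Set.Ioi (1 : ℝ), ‖mellinTerm c w p t‖ := by
  let W : ℤ → ℝ := fun j => ∫ t in Set.Ioi (1 : ℝ),
    t ^ |(w + j - 1).re| * Real.exp (-(2 * Real.pi * (t - 1 / 2)))
  have hrow : ∀ j ∈ S, HasSum (fun m : ℤ => ‖c (j, m)‖ * Real.exp (-(Real.pi * m)) * W j)
      (∑' m : ℤ, ‖c (j, m)‖ * Real.exp (-(Real.pi * m)) * W j) :=
    fun j _ => ((hsum j).mul_right (W j)).hasSum
  have hs : Summable fun p : ℤ × ℤ => ‖c p‖ * Real.exp (-(Real.pi * p.2)) * W p.1 :=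
    (hasSum_of_rows (g := fun p : ℤ × ℤ => ‖c p‖ * Real.exp (-(Real.pi * p.2)) * W p.1)
      (fun j hj m => by simp [hS j hj]) hrow).summable
  refine hs.of_nonneg_of_le (fun p => integral_nonneg fun t => norm_nonneg _) fun p => ?_
  rw [← integral_const_mul]
  refine setIntegral_mono_on (integrableOn_mellinTerm hc w p).norm
    ((integrableOn_rpow_mul_exp (abs_nonneg _)).const_mul _) measurableSet_Ioi fun t ht =>
    norm_mellinTerm_le hc w p ht

lemma integral_mellinTerm {c : ℤ × ℤ → ℂ} (hc : ∀ p : ℤ × ℤ, p.2 ≤ 0 → c p = 0) (w : ℂ)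
    (p : ℤ × ℤ) : ∫ t in Set.Ioi (1 : ℝ), mellinTerm c w p t =
      c p * incGamma (w + p.1) (2 * Real.pi * (p.2 : ℂ)) /
        (2 * Real.pi * (p.2 : ℂ)) ^ (w + p.1) := by
  rcases le_or_gt p.2 0 with hp | hp
  · simp [mellinTerm, hc p hp]
  have hx : (0 : ℝ) < 2 * Real.pi * p.2 := by
    have : (0 : ℝ) < p.2 := by exact_mod_cast hp
    positivity
  have hcast : (2 * Real.pi * (p.2 : ℂ)) = ((2 * Real.pi * p.2 : ℝ) : ℂ) := by push_cast; rfl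
  rw [hcast, mul_div_assoc, incGamma_div_cpow _ hx, ← integral_const_mul]
  rfl

/-! ### Termwise Mellin transform and comparison with the series -/

namespace IsEigenExpansion

variable {r s k₀ : ℤ} {f : ℍ → ℂ} {E : EigenCoeffs} {M N : ℕ}

/-- The coefficients `a j m + b j m` with `m > 0`. -/
def _root_.RealAnalyticModular.EigenCoeffs.posCoeff (E : EigenCoeffs) (p : ℤ × ℤ) : ℂ :=
  if 0 < p.2 then E.a p.1 p.2 + E.b p.1 p.2 else 0

lemma posCoeff_eq_zero (p : ℤ × ℤ) (hp : p.2 ≤ 0) : E.posCoeff p = 0 := by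
  simp [EigenCoeffs.posCoeff, not_lt.2 hp]

lemma norm_nome_zpow (z : ℍ) (m : ℤ) :
    ‖nome (z : ℂ) ^ m‖ = Real.exp (-(2 * Real.pi * m * z.im)) := by
  have := norm_nomeMonomial m 0 (z : ℂ)
  simpa [nomeMonomial] using this

lemma summable_posCoeff (h : IsEigenExpansion r s k₀ f E) (j : ℤ) :
    Summable fun m : ℤ => ‖E.posCoeff (j, m)‖ * Real.exp (-(Real.pi * m)) := by
  have hz : 0 < (I / 2 : ℂ).im := by simp
  let z : ℍ := ⟨I / 2, hz⟩
  have him : z.im = 1 / 2 := by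
    change (I / 2 : ℂ).im = 1 / 2
    simp
  have hn : ∀ m : ℤ, ‖nome (z : ℂ) ^ m‖ = Real.exp (-(Real.pi * m)) := by
    intro m
    rw [norm_nome_zpow, him]
    congr 1
    ring
  have ha := (h.summable_a j z).norm
  have hb := (h.summable_b j z).norm
  simp only [norm_mul, ← map_zpow₀, norm_conj, hn] at ha hb
  refine (ha.add hb).of_nonneg_of_le (fun m => by positivity) fun m => ?_
  rw [← add_mul]
  gcongr
  rw [EigenCoeffs.posCoeff]
  split_ifs
  · exact norm_add_le _ _
  · rw [norm_zero]
    positivity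

lemma coeff_eq_zero (h : IsEigenExpansion r s k₀ f E)
    (hA : IsFourierExpansion f M N (E.doubleCoeff r s k₀)) {j m : ℤ}
    (hjm : j ∉ Finset.Icc (-(M : ℤ)) (M : ℤ) ∨ m < -(N : ℤ)) : E.a j m = 0 ∧ E.b j m = 0 := by
  rw [Finset.mem_Icc, ← abs_le, not_le] at hjm
  by_cases hm : m = 0
  · exact ⟨h.a_eq_zero (by tauto), h.b_eq_zero (by tauto)⟩
  · constructor
    · rw [← EigenCoeffs.doubleCoeff_left (r := r) (s := s) (k₀ := k₀) hm]
      exact hA.support j m 0 (by tauto)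
    · rw [← EigenCoeffs.doubleCoeff_right (r := r) (s := s) (k₀ := k₀) hm]
      exact hA.support j 0 m (by tauto)

lemma posCoeff_row (h : IsEigenExpansion r s k₀ f E)
    (hA : IsFourierExpansion f M N (E.doubleCoeff r s k₀)) (j : ℤ)
    (hj : j ∉ Finset.Icc (-(M : ℤ)) (M : ℤ)) (m : ℤ) : E.posCoeff (j, m) = 0 := by
  have := h.coeff_eq_zero hA (m := m) (Or.inl hj)
  simp [EigenCoeffs.posCoeff, this.1, this.2]

lemma nome_I_mul (t : ℝ) (m : ℤ) : nome (I * t) ^ m = cexp (-((2 * Real.pi * m : ℝ) * t)) := by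
  rw [nome, ← Complex.exp_int_mul]
  congr 1
  push_cast
  linear_combination (2 * Real.pi * m * t) * I_sq

lemma conj_nome_I_mul (t : ℝ) : conj (nome (I * t)) = nome (I * t) := by
  rw [nome, ← Complex.exp_conj]
  congr 1
  simp only [map_mul, conj_ofReal, conj_I, map_ofNat]
  ring

lemma hasSum_decayingPart (h : IsEigenExpansion r s k₀ f E)
    (hA : IsFourierExpansion f M N (E.doubleCoeff r s k₀)) (w : ℂ) {t : ℝ} (ht : 0 < t) :
    HasSum (fun p => mellinTerm E.posCoeff w p t)
      (decayingPart M (E.doubleCoeff r s k₀) (I * t) * (t : ℂ) ^ (w - 1)) := by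
  have him : 0 < (I * t : ℂ).im := by simpa using ht
  have ht' : (t : ℂ) ≠ 0 := by exact_mod_cast ht.ne'
  rw [decayingPart, Finset.sum_mul]
  refine hasSum_of_rows (S := Finset.Icc (-(M : ℤ)) (M : ℤ))
    (fun j hj m => by simp [mellinTerm, h.posCoeff_row hA j hj m]) fun j _ => ?_
  -- The coefficients live on the two axes `m = 0` and `n = 0`, where `0 < m + n` means that the
  -- remaining exponent is positive; the decaying part is thus again given by eigenform-type
  -- coefficients.
  let E' : EigenCoeffs := ⟨0, 0, fun j m => if 0 < m then E.a j m else 0,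
    fun j m => if 0 < m then E.b j m else 0⟩
  have ha : Summable fun m : ℤ => E'.a j m * nome (I * t) ^ m := by
    refine ((h.summable_a j ⟨_, him⟩).indicator {m | 0 < m}).congr fun m => ?_
    by_cases hm : 0 < m <;> simp [E', hm]
  have hb : Summable fun m : ℤ => E'.b j m * conj (nome (I * t)) ^ m := by
    refine ((h.summable_b j ⟨_, him⟩).indicator {m | 0 < m}).congr fun m => ?_
    by_cases hm : 0 < m <;> simp [E', hm]
  have hd := EigenCoeffs.hasSum_doubleCoeff (r := r) (s := s) (k₀ := k₀) ha hb
  have hE : ∀ p : ℤ × ℤ, E'.doubleCoeff r s k₀ j p.1 p.2 * nomeMonomial p.1 p.2 (I * t) =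
      if 0 < p.1 + p.2 then
        E.doubleCoeff r s k₀ j p.1 p.2 * nomeMonomial p.1 p.2 (I * t) else 0 := by
    rintro ⟨m, n⟩
    rw [← ite_zero_mul]
    congr 1
    by_cases hm : m = 0 <;> by_cases hn : n = 0 <;>
      simp [EigenCoeffs.doubleCoeff, E', hm, hn]
  simp only [hE] at hd
  rw [hd.tsum_eq]
  have hsum := (ha.hasSum.add hb.hasSum).mul_left ((t : ℂ) ^ j * (t : ℂ) ^ (w - 1))
  have hval : ((I * t : ℂ).im : ℂ) ^ j * ((if j = k₀ then E'.α else 0) +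
      (if j = 1 - r - s - k₀ then E'.β else 0) + ∑' m : ℤ, E'.a j m * nome (I * t) ^ m +
      ∑' m : ℤ, E'.b j m * conj (nome (I * t)) ^ m) * (t : ℂ) ^ (w - 1) =
      (t : ℂ) ^ j * (t : ℂ) ^ (w - 1) * (∑' m : ℤ, E'.a j m * nome (I * t) ^ m +
      ∑' m : ℤ, E'.b j m * conj (nome (I * t)) ^ m) := by
    have h1 : ((I * t : ℂ).im : ℂ) = t := by simp
    have h2 : (if j = k₀ then E'.α else 0) = 0 := ite_self _
    have h3 : (if j = 1 - r - s - k₀ then E'.β else 0) = 0 := ite_self _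
    rw [h1, h2, h3]
    ring
  rw [hval]
  refine hsum.congr_fun fun m => ?_
  rw [mellinTerm, conj_nome_I_mul, nome_I_mul, add_sub_right_comm, Complex.cpow_add _ _ ht',
    Complex.cpow_intCast]
  by_cases hm : 0 < m
  · simp only [EigenCoeffs.posCoeff, E', hm, if_true]
    ring
  · simp [EigenCoeffs.posCoeff, E', hm]

lemma hasSum_integral_decayingPart (h : IsEigenExpansion r s k₀ f E)
    (hA : IsFourierExpansion f M N (E.doubleCoeff r s k₀)) (w : ℂ) :
    HasSum (fun p : ℤ × ℤ => E.posCoeff p * incGamma (w + p.1) (2 * Real.pi * (p.2 : ℂ)) /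
        (2 * Real.pi * (p.2 : ℂ)) ^ (w + p.1))
      (∫ t in Set.Ioi (1 : ℝ), decayingPart M (E.doubleCoeff r s k₀) (I * t) *
        (t : ℂ) ^ (w - 1)) := by
  have h1 := hasSum_integral_of_summable_integral_norm
    (fun p => integrableOn_mellinTerm (posCoeff_eq_zero (E := E)) w p)
    (summable_integral_norm_mellinTerm posCoeff_eq_zero (h.posCoeff_row hA) h.summable_posCoeff w)
  simp only [integral_mellinTerm (posCoeff_eq_zero (E := E))] at h1
  have h2 : ∫ t in Set.Ioi (1 : ℝ), decayingPart M (E.doubleCoeff r s k₀) (I * t) *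
      (t : ℂ) ^ (w - 1) = ∫ t in Set.Ioi (1 : ℝ), ∑' p, mellinTerm E.posCoeff w p t :=
    setIntegral_congr_fun measurableSet_Ioi fun t ht =>
      (h.hasSum_decayingPart hA w (zero_lt_one.trans (Set.mem_Ioi.1 ht))).tsum_eq.symm
  rwa [h2]

lemma seriesTerm_eq_add (w : ℂ) (p : ℤ × ℤ) : seriesTerm E w p =
    E.posCoeff p * incGamma (w + p.1) (2 * Real.pi * (p.2 : ℂ)) /
        (2 * Real.pi * (p.2 : ℂ)) ^ (w + p.1) + if p.2 < 0 then seriesTerm E w p else 0 := by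
  rcases lt_trichotomy p.2 0 with hp | hp | hp
  · simp [EigenCoeffs.posCoeff, hp, hp.not_gt]
  · simp [EigenCoeffs.posCoeff, seriesTerm, hp]
  · simp [EigenCoeffs.posCoeff, seriesTerm, hp, hp.not_gt, hp.ne']

lemma hasSum_neg (h : IsEigenExpansion r s k₀ f E)
    (hA : IsFourierExpansion f M N (E.doubleCoeff r s k₀)) (w : ℂ) :
    HasSum (fun p => if p.2 < 0 then seriesTerm E w p else 0)
      (∑ j ∈ Finset.Icc (-(M : ℤ)) (M : ℤ), ∑ m ∈ Finset.Icc (-(N : ℤ)) (N : ℤ),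
        if m < 0 then seriesTerm E w (j, m) else 0) := by
  rw [← Finset.sum_product']
  refine hasSum_sum_of_ne_finset_zero fun p hp => ?_
  split_ifs with hneg
  · have hz := h.coeff_eq_zero hA (j := p.1) (m := p.2) (by
      rw [Finset.mem_product] at hp
      by_cases h1 : p.1 ∈ Finset.Icc (-(M : ℤ)) (M : ℤ)
      · right
        have : p.2 ∉ Finset.Icc (-(N : ℤ)) (N : ℤ) := fun h2 => hp ⟨h1, h2⟩
        rw [Finset.mem_Icc] at this
        omega
      · exact Or.inl h1)
    simp [seriesTerm, hz.1, hz.2]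
  · rfl

/-- The terms with `m > 0` come from the termwise integration, and those with `m < 0` have finite
support. -/
theorem summable_norm_seriesTerm (h : IsEigenExpansion r s k₀ f E) (w : ℂ) :
    Summable fun p => ‖seriesTerm E w p‖ := by
  obtain ⟨M, N, hA⟩ := h.isFourierExpansion
  exact (((h.hasSum_integral_decayingPart hA w).add (h.hasSum_neg hA w)).congr_fun
    fun p => seriesTerm_eq_add w p).summable.norm

/-- The pairs `(m, 0)` and `(0, m)` carry the same factor, and together they form `a j m + b j m`.
-/
lemma sum_neg_eq (w : ℂ) (j : ℤ) :
    (∑ m ∈ Finset.Icc (-(N : ℤ)) (N : ℤ), ∑ n ∈ Finset.Icc (-(N : ℤ)) (N : ℤ),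
        if m + n < 0 then
          E.doubleCoeff r s k₀ j m n / (2 * Real.pi * ((m : ℂ) + n)) ^ ((j : ℂ) + w)
            * incGamma ((j : ℂ) + w) (2 * Real.pi * ((m : ℂ) + n))
        else 0) =
      ∑ m ∈ Finset.Icc (-(N : ℤ)) (N : ℤ), if m < 0 then seriesTerm E w (j, m) else 0 := by
  let G : ℤ → ℂ := fun m => if m < 0 then
    incGamma (w + j) (2 * Real.pi * (m : ℂ)) / (2 * Real.pi * (m : ℂ)) ^ (w + j) else 0
  have hterm : ∀ m n : ℤ, (if m + n < 0 then
          E.doubleCoeff r s k₀ j m n / (2 * Real.pi * ((m : ℂ) + n)) ^ ((j : ℂ) + w)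
            * incGamma ((j : ℂ) + w) (2 * Real.pi * ((m : ℂ) + n))
        else 0) = (if n = 0 then E.a j m * G m else 0) + (if m = 0 then E.b j n * G n else 0) := by
    intro m n
    rw [add_comm (j : ℂ) w]
    by_cases hm : m = 0 <;> by_cases hn : n = 0
    · simp [hm, hn, G]
    · by_cases h0 : n < 0 <;> simp [hm, hn, G, EigenCoeffs.doubleCoeff, h0]
      ring
    · by_cases h0 : m < 0 <;> simp [hm, hn, G, EigenCoeffs.doubleCoeff, h0]
      ring
    · simp [hm, hn, EigenCoeffs.doubleCoeff]
  have h0 : (0 : ℤ) ∈ Finset.Icc (-(N : ℤ)) (N : ℤ) := by simp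
  simp only [hterm, Finset.sum_add_distrib]
  rw [Finset.sum_comm (f := fun m n => if m = 0 then E.b j n * G n else 0)]
  simp only [Finset.sum_ite_eq', h0, if_true]
  rw [← Finset.sum_add_distrib]
  refine Finset.sum_congr rfl fun m _ => ?_
  by_cases hm : m < 0
  · simp only [G, hm, if_true, seriesTerm, hm.ne, if_false]
    ring
  · simp [G, hm]

lemma sum_pole_eq (h : IsEigenExpansion r s k₀ f E) (hk : k₀ < 1 - r - s - k₀)
    (hA : IsFourierExpansion f M N (E.doubleCoeff r s k₀)) (w : ℂ) :
    (∑ j ∈ Finset.Icc (-(M : ℤ)) (M : ℤ),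
      ∑ m ∈ Finset.Icc (-(N : ℤ)) (N : ℤ), ∑ n ∈ Finset.Icc (-(N : ℤ)) (N : ℤ),
        if m + n = 0 then E.doubleCoeff r s k₀ j m n / (w + j) else 0) =
      E.α / (w + k₀) + E.β / (w + (1 - r - s - k₀)) := by
  have hterm : ∀ j m n : ℤ, (if m + n = 0 then E.doubleCoeff r s k₀ j m n / (w + j) else 0) =
      if n = 0 then if m = 0 then E.doubleCoeff r s k₀ j 0 0 / (w + j) else 0 else 0 := by
    intro j m n
    by_cases hm : m = 0 <;> by_cases hn : n = 0
    · simp [hm, hn]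
    · simp [hm, hn]
    · simp [hm, hn]
    · simp [hm, hn, EigenCoeffs.doubleCoeff]
  have h0 : (0 : ℤ) ∈ Finset.Icc (-(N : ℤ)) (N : ℤ) := by simp
  -- The given expansion may use an `M` too small to include `k₀`, but then `α` vanishes and no term
  -- is lost.
  have hα : k₀ ∉ Finset.Icc (-(M : ℤ)) (M : ℤ) → E.α = 0 := fun hj => by
    have := hA.coeff_eq_zero hj 0 0
    rw [h.doubleCoeff_zero] at this
    simpa [hk.ne] using this
  have hβ : 1 - r - s - k₀ ∉ Finset.Icc (-(M : ℤ)) (M : ℤ) → E.β = 0 := fun hj => by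
    have := hA.coeff_eq_zero hj 0 0
    rw [h.doubleCoeff_zero] at this
    simpa [hk.ne'] using this
  simp only [hterm, Finset.sum_ite_eq', h0, if_true, h.doubleCoeff_zero, add_div, ite_div,
    zero_div, Finset.sum_add_distrib]
  congr 1
  · split_ifs with hj
    · rfl
    · rw [hα hj, zero_div]
  · push_cast
    split_ifs with hj
    · rfl
    · rw [hβ hj, zero_div]

theorem halfL_eq (h : IsEigenExpansion r s k₀ f E) (hk : k₀ < 1 - r - s - k₀)
    (hA : IsFourierExpansion f M N (E.doubleCoeff r s k₀)) (w : ℂ) :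
    halfL M N (E.doubleCoeff r s k₀) w = ∑' p : ℤ × ℤ, seriesTerm E w p -
      (E.α / (w + k₀) + E.β / (w + (1 - r - s - k₀))) := by
  have hs := ((h.hasSum_integral_decayingPart hA w).add (h.hasSum_neg hA w)).congr_fun
    fun p => seriesTerm_eq_add w p
  rw [halfL, h.sum_pole_eq hk hA, hs.tsum_eq]
  simp only [sum_neg_eq]

/-- By uniqueness every expansion of `f` has the coefficients given by `E`. The formula then adds
two instances of `halfL_eq`; the reflection `w ↦ r + s - w` changes the sign of the denominators,
whence the signs in `polarPart`. -/
theorem completedL_eq (h : IsEigenExpansion r s k₀ f E) (hk : k₀ < 1 - r - s - k₀)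
    {A : ℤ → ℤ → ℤ → ℂ} (hA : IsFourierExpansion f M N A) (w : ℂ) :
    completedL r s M N A w = ∑' p : ℤ × ℤ, seriesTerm E w p
      + I ^ (r - s) * ∑' p : ℤ × ℤ, seriesTerm E ((r : ℂ) + s - w) p
      + polarPart r s k₀ E w := by
  obtain rfl := h.doubleCoeff_eq hA
  rw [completedL, h.halfL_eq hk hA, h.halfL_eq hk hA, polarPart]
  have e1 : (r : ℂ) + s - w + k₀ = -(w - k₀ - r - s) := by ring
  have e2 : (r : ℂ) + s - w + (1 - r - s - k₀) = -(w + k₀ - 1) := by ring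
  have e3 : w + (1 - r - s - k₀) = w - k₀ - r - s + 1 := by ring
  rw [e1, e2, e3, div_neg, div_neg]
  ring

end IsEigenExpansion

end

end RealAnalyticModular

theorem proposition3p2 (r s : ℤ) (hrs : Even (r - s)) (lam : ℝ) (f : ℍ → ℂ)
    (hf : RealAnalyticModular.IsEigenform r s lam f) :
    (f ≠ 0 → ∃ k₀ : ℤ, k₀ < 1 - r - s - k₀ ∧ lam = ((k₀ * (1 - r - s - k₀) : ℤ) : ℝ)) ∧
    ∀ k₀ : ℤ, k₀ < 1 - r - s - k₀ → lam = ((k₀ * (1 - r - s - k₀) : ℤ) : ℝ) →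
      (∃! E : RealAnalyticModular.EigenCoeffs,
        RealAnalyticModular.IsEigenExpansion r s k₀ f E) ∧
      ∀ E : RealAnalyticModular.EigenCoeffs,
        RealAnalyticModular.IsEigenExpansion r s k₀ f E →
        (∀ j ∈ Finset.Icc k₀ (-s), ∃ C : ℝ, 0 < C ∧
          (fun n : ℕ => E.a j (n : ℤ)) =O[atTop] fun n : ℕ => Real.exp (C * √(n : ℝ))) ∧
        (∀ j ∈ Finset.Icc k₀ (-r), ∃ C : ℝ, 0 < C ∧
          (fun n : ℕ => E.b j (n : ℤ)) =O[atTop] fun n : ℕ => Real.exp (C * √(n : ℝ))) ∧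
        (∀ w : ℂ,
          Summable (fun p : ℤ × ℤ => ‖RealAnalyticModular.seriesTerm E w p‖) ∧
          Summable (fun p : ℤ × ℤ =>
            ‖RealAnalyticModular.seriesTerm E ((r : ℂ) + s - w) p‖)) ∧
        (∀ (M N : ℕ) (A : ℤ → ℤ → ℤ → ℂ), RealAnalyticModular.IsFourierExpansion f M N A →
          ∀ w : ℂ, w ≠ -k₀ → w ≠ -k₀ + 1 → w ≠ k₀ + r + s - 1 → w ≠ k₀ + r + s →
            RealAnalyticModular.completedL r s M N A w =
              ∑' p : ℤ × ℤ, RealAnalyticModular.seriesTerm E w p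
              + I ^ (r - s) *
                ∑' p : ℤ × ℤ, RealAnalyticModular.seriesTerm E ((r : ℂ) + s - w) p
              + RealAnalyticModular.polarPart r s k₀ E w) := by
  refine ⟨hf.exists_root hrs, fun k₀ hk hlam =>
    ⟨hf.existsUnique_expansion hk hlam, fun E hE => ⟨fun j _ => hE.isBigO_a hf.isModularForm j,
      fun j _ => hE.isBigO_b hf.isModularForm j,
      fun w => ⟨hE.summable_norm_seriesTerm w, hE.summable_norm_seriesTerm _⟩,
      fun M N A hA w _ _ _ _ => hE.completedL_eq hk hA w⟩⟩⟩
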